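/- For positive integers $d,N$, a $d$-dimensional array of size $N\times\cdots\times N$ is an injective function $f\colon A_1\times\cdots\times A_d\to\mathbb{R}$, where $A_1,\dots,A_d\subset\mathbb{Z}$ each have exactly $N$ elements; a subarray of size $n\times\cdots\times n$ is its restriction to $B_1\times\cdots\times B_d$ with $B_i\subseteq A_i$ and $|B_i|=n$ for all $i$. An array $f$ is lex-monotone if there exist a permutation $\sigma$ of $\{1,\dots,d\}$ and signs $s_1,\dots,s_d\in\{-1,1\}$ such that, for all $x,y$ in its domain, $$f(x)<f(y)\iff (s_{\sigma(1)}x_{\sigma(1)},\dots,s_{\sigma(d)}x_{\sigma(d)})<_{\mathrm{lex}}(s_{\sigma(1)}y_{\sigma(1)},\dots,s_{\sigma(d)}y_{\sigma(d)}),$$ where $u<_{\mathrm{lex}}v$ means that $u_i<v_i$ for the smallest index $i$ with $u_i\ne v_i$. Let $L_d(n)$ be the minimum positive integer $N$ such that every $d$-dimensional array of size $N\times\cdots\times N$ contains a lex-monotone subarray of size $n\times\cdots\times n$. Let $\mathrm{tower}_1(x)=x$ and $\mathrm{tower}_k(x)=2^{\mathrm{tower}_{k-1}(x)}$ for $k\ge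 2$. Theorem. For all $d\ge 2$ and $n\ge 1$ the number $L_d(n)$ exists, and (i) $L_2(n)\le 2^{2^{(4+o(1))n^2}}$, (ii) $L_3(n)\le 2^{2^{2^{(2+o(1))n}}}$, (iii) for every $d\ge 4$ there is a constant $C_d>0$ with $L_d(n)\le \mathrm{tower}_5(C_d\,n^{d-2})$ for all $n\ge 1$, where the terms $o(1)$ tend to $0$ as $n\to\infty$. -/

import Mathlib

open Filter Topology

/-- The grid `A₁ × ⋯ × A_d`, as a set of integer points. -/
def grid {d : ℕ} (A : Fin d → Finset ℤ) : Set (Fin d → ℤ) :=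
  {x | ∀ i, x i ∈ A i}

/-- `f` is a `d`-dimensional array indexed by `A₁ × ⋯ × A_d`: the sets `A_i ⊆ ℤ` are non-empty
and `f` is injective on the grid. Only the values of `f` on the grid matter. -/
def IsArray {d : ℕ} (A : Fin d → Finset ℤ) (f : (Fin d → ℤ) → ℝ) : Prop :=
  (∀ i, (A i).Nonempty) ∧ Set.InjOn f (grid A)

/-- The grid `A₁ × ⋯ × A_d` has size `n × ⋯ × n`. -/
def HasSize {d : ℕ} (A : Fin d → Finset ℤ) (n : ℕ) : Prop :=
  ∀ i, (A i).card = n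

/-- The restriction of `f` to the grid `A₁ × ⋯ × A_d` is lex-monotone: for some permutation `σ`
and some sign vector `s` (the units of `ℤ` are `1` and `-1`), `f x < f y` holds exactly if
`(s_{σ(1)} x_{σ(1)}, …, s_{σ(d)} x_{σ(d)})` is lexicographically smaller than
`(s_{σ(1)} y_{σ(1)}, …, s_{σ(d)} y_{σ(d)})`. -/
def IsLexMonotone {d : ℕ} (A : Fin d → Finset ℤ) (f : (Fin d → ℤ) → ℝ) : Prop :=
  ∃ (σ : Equiv.Perm (Fin d)) (s : Fin d → ℤˣ), ∀ x ∈ grid A, ∀ y ∈ grid A,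
    (f x < f y ↔
      toLex (fun i => (s (σ i) : ℤ) * x (σ i)) < toLex (fun i => (s (σ i) : ℤ) * y (σ i)))

/-- The positive integers `N` such that every `d`-dimensional array of size `N × ⋯ × N` has a
lex-monotone subarray of size `n × ⋯ × n`. -/
def lexRamseySet (d n : ℕ) : Set ℕ :=
  {N | 0 < N ∧ ∀ (A : Fin d → Finset ℤ) (f : (Fin d → ℤ) → ℝ), IsArray A f → HasSize A N →
    ∃ B : Fin d → Finset ℤ, (∀ i, B i ⊆ A i) ∧ HasSize B n ∧ IsLexMonotone B f}

/-- The lex-monotone Ramsey number `L_d(n)`. -/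
noncomputable def lexRamsey (d n : ℕ) : ℕ := sInf (lexRamseySet d n)

/-- The tower function: `tower 1 x = x` and `tower (k + 1) x = 2 ^ tower k x` for `k ≥ 1`
(the value at `k = 0` plays no role). -/
noncomputable def tower : ℕ → ℝ → ℝ
  | 0, x => x
  | 1, x => x
  | k + 2, x => (2 : ℝ) ^ tower (k + 1) x

/-! The proof has two stages. The first passes to a subarray that is monotone along every coordinate
axis, with one direction per axis. After reflecting axes this is a strictly increasing function on a
box of integers. The second stage finds a lexicographically ordered subarray of such a function.

First stage (`MonoRamsey.cons`, `LineRamsey.cons`): slice along one coordinate, apply induction to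
each slice, and keep many slices with the same outcome. Two slices are compared by the signs of the
differences of their values. Having a prescribed sign pattern on a prescribed subgrid is a
transitive relation between slices, so the Erdős–Szekeres argument `exists_chain_of_pow_card_le`
finds a long chain without invoking Ramsey's theorem for pairs. In dimensions 2 and 3 the pattern is
made constant on a subgrid within each step. In general all patterns are allowed first, and one
application of `exists_gridRamsey` makes the directions uniform at the end; the result is triply
exponential in a power of the side length.

Second stage (`exists_dominating_coordinate`): for an increasing function, a cyclic family of d + 1
points, d + 1 being the number of coordinates, must contain a descent. That descent forces one
coordinate to outweigh all the others inside a box. Recursing in the slices orthogonal to it and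
pigeonholing gives the lexicographic order. The side length needed is 2n² + 1 for d = 2, about 2^n
up to a polynomial for d = 3 (`monoLexRamsey_three`), and 2^(C n^(d-2)) in general. Composing the
two stages in `mem_lexRamseySet` gives the bounds. -/

open Finset

/-! ### Chains for several transitive relations -/

/-- Erdős–Szekeres for several transitive relations covering all pairs. -/
theorem exists_chain_of_pow_card_le {κ : Type*} (C : Finset κ) (hC : C.Nonempty)
    (r : κ → ℤ → ℤ → Prop)
    (htrans : ∀ c ∈ C, ∀ x y z, r c x y → r c y z → r c x z) (T : Finset ℤ)
    (hcover : ∀ a ∈ T, ∀ b ∈ T, a < b → ∃ c ∈ C, r c a b) {k : ℕ} (hk : 1 ≤ k)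
    (hcard : k ^ C.card ≤ T.card) :
    ∃ c ∈ C, ∃ U ⊆ T, U.card = k ∧ ∀ a ∈ U, ∀ b ∈ U, a < b → r c a b := by
  classical
  -- These chains can all be prolonged by `a` but do not contain it, so `len c a` is one less than
  -- the longest chain ending at `a`. Without a chain of size `k`, the vectors of lengths embed `T`
  -- into a cube of side `k - 1`.
  let chains (c : κ) (a : ℤ) : Finset (Finset ℤ) := T.powerset.filter fun U =>
    (∀ u ∈ U, u < a ∧ r c u a) ∧ ∀ u ∈ U, ∀ v ∈ U, u < v → r c u v
  let len (c : κ) (a : ℤ) : ℕ := (chains c a).sup Finset.card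
  have hmem : ∀ c a, ∃ U ∈ chains c a, U.card = len c a := by
    intro c a
    obtain ⟨U, hU, h⟩ := Finset.exists_mem_eq_sup (chains c a) ⟨∅, by simp [chains]⟩ Finset.card
    exact ⟨U, hU, h.symm⟩
  have hext : ∀ c a, a ∈ T → ∃ U ⊆ T, U.card = len c a + 1 ∧ a ∈ U ∧ (∀ u ∈ U, u ≤ a) ∧
      ∀ u ∈ U, ∀ v ∈ U, u < v → r c u v := by
    intro c a ha
    obtain ⟨U, hU, hlen⟩ := hmem c a
    simp only [chains, mem_filter, mem_powerset] at hU
    obtain ⟨hUT, h1, h2⟩ := hU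
    have haU : a ∉ U := fun h => lt_irrefl _ (h1 a h).1
    refine ⟨insert a U, insert_subset ha hUT, by rw [card_insert_of_notMem haU, hlen],
      mem_insert_self _ _, ?_, ?_⟩
    · intro u hu
      rcases mem_insert.1 hu with rfl | hu
      · exact le_rfl
      · exact (h1 u hu).1.le
    · intro u hu v hv huv
      rcases mem_insert.1 hv with hv | hv
      · rcases mem_insert.1 hu with hu | hu
        · exact absurd huv (by rw [hu, hv]; exact lt_irrefl _)
        · exact hv ▸ (h1 u hu).2
      · rcases mem_insert.1 hu with hu | hu
        · exact absurd (huv.trans (h1 v hv).1) (by rw [hu]; exact lt_irrefl _)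
        · exact h2 u hu v hv huv
  by_contra! hno
  have hlt : ∀ c ∈ C, ∀ a ∈ T, len c a < k - 1 := by
    intro c hc a ha
    by_contra! hge
    obtain ⟨U, hUT, hcardU, -, -, hU⟩ := hext c a ha
    obtain ⟨V, hVU, hV⟩ := Finset.exists_subset_card_eq (s := U) (n := k) (by omega)
    obtain ⟨u, hu, v, hv, huv, hr⟩ := hno c hc V (hVU.trans hUT) hV
    exact hr (hU u (hVU hu) v (hVU hv) huv)
  have hmono : ∀ c ∈ C, ∀ a ∈ T, ∀ b ∈ T, a < b → r c a b → len c a < len c b := by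
    intro c hc a ha b hb hab hr
    obtain ⟨U, hUT, hcardU, haU, hle, hU⟩ := hext c a ha
    have : U ∈ chains c b := by
      simp only [chains, mem_filter, mem_powerset]
      refine ⟨hUT, fun u hu => ⟨(hle u hu).trans_lt hab, ?_⟩, hU⟩
      rcases (hle u hu).eq_or_lt with rfl | h
      · exact hr
      · exact htrans c hc _ _ _ (hU u hu a haU h) hr
    have := Finset.le_sup (f := Finset.card) this
    change U.card ≤ len c b at this
    omega
  have hinj : T.card ≤ (Fintype.piFinset fun _ : C => range (k - 1)).card := by
    refine Finset.card_le_card_of_injOn (fun a c => len c a) ?_ ?_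
    · intro a ha
      simp only [Fintype.coe_piFinset, Set.mem_pi, Set.mem_univ, coe_range, Set.mem_Iio,
        forall_const]
      exact fun c => hlt c c.2 a ha
    · intro a ha b hb hab
      have hne : ∀ a ∈ T, ∀ b ∈ T, a < b →
          (fun c : C => len c a) ≠ fun c : C => len c b := by
        intro a ha b hb hlt heq
        obtain ⟨c, hc, hr⟩ := hcover a ha b hb hlt
        exact (hmono c hc a ha b hb hlt hr).ne (congrFun heq ⟨c, hc⟩)
      rcases lt_trichotomy a b with h | h | h
      · exact absurd hab (hne a ha b hb h)
      · exact h
      · exact absurd hab.symm (hne b hb a ha h)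
  rw [Fintype.card_piFinset] at hinj
  simp only [card_range, prod_const, card_univ, Fintype.card_coe] at hinj
  have : (k - 1) ^ C.card < k ^ C.card := Nat.pow_lt_pow_left (by omega) hC.card_pos.ne'
  omega

/-! ### Subgrids and homogeneous subgrids of coloured grids -/

/-- The subgrids of `A` with prescribed side lengths. -/
def subgrids {d : ℕ} {α : Type*} (A : Fin d → Finset α) (n : Fin d → ℕ) :
    Finset (Fin d → Finset α) :=
  Fintype.piFinset fun i => powersetCard (n i) (A i)

theorem mem_subgrids {d : ℕ} {α : Type*} {A B : Fin d → Finset α} {n : Fin d → ℕ} :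
    B ∈ subgrids A n ↔ ∀ i, B i ⊆ A i ∧ (B i).card = n i := by
  simp [subgrids, mem_powersetCard]

theorem card_subgrids {d : ℕ} {α : Type*} (A : Fin d → Finset α) (n : Fin d → ℕ) :
    (subgrids A n).card = ∏ i, ((A i).card).choose (n i) := by
  simp [subgrids, Fintype.card_piFinset]

theorem exists_subgrid {d : ℕ} {α : Type*} (A : Fin d → Finset α) (n : Fin d → ℕ)
    (h : ∀ i, n i ≤ (A i).card) : ∃ B, B ∈ subgrids A n := by
  choose B hB using fun i => Finset.exists_subset_card_eq (h i)
  exact ⟨B, mem_subgrids.2 hB⟩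

theorem piFinset_subset_of_mem_subgrids {d : ℕ} {α : Type*} {A B : Fin d → Finset α}
    {n : Fin d → ℕ} (h : B ∈ subgrids A n) : Fintype.piFinset B ⊆ Fintype.piFinset A :=
  Fintype.piFinset_subset _ _ fun i => (mem_subgrids.1 h i).1

theorem cons_mem_piFinset {d : ℕ} {α : Type*} {A : Fin (d + 1) → Finset α} {t : α}
    {x : Fin d → α} :
    (Fin.cons t x : Fin (d + 1) → α) ∈ Fintype.piFinset A ↔
      t ∈ A 0 ∧ x ∈ Fintype.piFinset (Fin.tail A) := by
  simp [Fintype.mem_piFinset, Fin.forall_fin_succ, Fin.tail]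

theorem cons_mem_subgrids {d : ℕ} {α : Type*} {A : Fin (d + 1) → Finset α}
    {U : Finset α} {B : Fin d → Finset α} {n : Fin (d + 1) → ℕ} :
    (Fin.cons U B : Fin (d + 1) → Finset α) ∈ subgrids A n ↔
      (U ⊆ A 0 ∧ U.card = n 0) ∧ B ∈ subgrids (Fin.tail A) (Fin.tail n) := by
  simp [mem_subgrids, Fin.forall_fin_succ, Fin.tail]

theorem subgrids_trans {d : ℕ} {α : Type*} {A B G : Fin d → Finset α} {n m : Fin d → ℕ}
    (hB : B ∈ subgrids A n) (hG : G ∈ subgrids B m) : G ∈ subgrids A m := by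
  rw [mem_subgrids] at *
  exact fun i => ⟨(hG i).1.trans (hB i).1, (hG i).2⟩

/-- Every `κ`-colouring of a grid with side lengths at least `w` is constant on some subgrid
with side lengths `m`. -/
def GridRamsey (κ : Type) {d : ℕ} (w m : Fin d → ℕ) : Prop :=
  ∀ (A : Fin d → Finset ℤ) (χ : (Fin d → ℤ) → κ), (∀ i, w i ≤ (A i).card) →
    ∃ B ∈ subgrids A m, ∃ c, ∀ x ∈ Fintype.piFinset B, χ x = c

theorem gridRamsey_zero (κ : Type) (w m : Fin 0 → ℕ) : GridRamsey κ w m := by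
  intro A χ _
  refine ⟨A, by simp [mem_subgrids], χ 0, fun x _ => by rw [Subsingleton.elim x 0]⟩

/-- Each slice has a monochromatic subgrid. There are at most (number of subgrids) × (number of
colours) outcomes, so `k` slices share both subgrid and colour. -/
theorem GridRamsey.cons {κ : Type} [Fintype κ] [Nonempty κ] {d : ℕ} {w m : Fin d → ℕ}
    (h : GridRamsey κ w m) {W k : ℕ}
    (hW : (∏ i, (w i).choose (m i)) * Fintype.card κ * k ≤ W) :
    GridRamsey κ (Fin.cons W w : Fin (d + 1) → ℕ) (Fin.cons k m : Fin (d + 1) → ℕ) := by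
  classical
  intro A χ hA
  obtain ⟨A', hA'⟩ := exists_subgrid (Fin.tail A) w fun i => by simpa [Fin.tail] using hA i.succ
  have hcard : ∀ i, (A' i).card = w i := fun i => (mem_subgrids.1 hA' i).2
  choose B hB c hc using fun t : ℤ =>
    h A' (fun x => χ (Fin.cons t x : Fin (d + 1) → ℤ)) fun i => (hcard i).ge
  obtain ⟨⟨G, e⟩, -, hfib⟩ := Finset.exists_le_card_fiber_of_mul_le_card_of_maps_to
    (s := A 0) (t := subgrids A' m ×ˢ (univ : Finset κ)) (f := fun t => (B t, c t)) (n := k)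
    (fun t _ => by simp [hB t])
    ⟨(B 0, c 0), by simp [hB 0]⟩ (by
      rw [card_product, card_subgrids, card_univ]
      simp only [hcard]
      exact hW.trans (by simpa using hA 0))
  obtain ⟨U, hU, hUk⟩ := Finset.exists_subset_card_eq hfib
  have hU' : ∀ t ∈ U, t ∈ A 0 ∧ B t = G ∧ c t = e := fun t ht => by
    simpa [Prod.ext_iff] using hU ht
  by_cases hUe : U.Nonempty
  · obtain ⟨t₀, ht₀⟩ := hUe
    have hG : G ∈ subgrids A' m := (hU' t₀ ht₀).2.1 ▸ hB t₀
    refine ⟨Fin.cons U G, cons_mem_subgrids.2 ⟨⟨fun t ht => (hU' t ht).1, by simpa using hUk⟩, ?_⟩,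
      e, fun x hx => ?_⟩
    · simpa using subgrids_trans hA' hG
    · rw [← Fin.cons_self_tail x] at hx ⊢
      obtain ⟨h0, h1⟩ := cons_mem_piFinset.1 hx
      obtain ⟨-, hBG, hce⟩ := hU' _ h0
      rw [← hce]
      exact hc _ _ (hBG ▸ h1)
  · rw [not_nonempty_iff_eq_empty] at hUe
    subst hUe
    -- This is the case `k = 0`: the grid has an empty side and the colour condition is vacuous.
    refine ⟨Fin.cons ∅ (B 0), cons_mem_subgrids.2 ⟨⟨by simp, by simpa using hUk⟩, ?_⟩, e,
      fun x hx => ?_⟩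
    · simpa using subgrids_trans hA' (hB 0)
    · simpa using Fintype.mem_piFinset.1 hx 0

/-! ### Monotone subarrays -/

/-- `f` is strictly increasing on the grid `B` along direction `i` with respect to the order
of `s i * x i`. -/
def SignMono {d : ℕ} (B : Fin d → Finset ℤ) (f : (Fin d → ℤ) → ℝ) (s : Fin d → ℤˣ) : Prop :=
  ∀ i, ∀ x ∈ Fintype.piFinset B, ∀ a ∈ B i, ∀ b ∈ B i, (s i : ℤ) * a < (s i : ℤ) * b →
    f (Function.update x i a) < f (Function.update x i b)

/-- Every line of the grid `B` is monotone for `f`, the directions being arbitrary. -/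
def LineMono {d : ℕ} (B : Fin d → Finset ℤ) (f : (Fin d → ℤ) → ℝ) : Prop :=
  ∀ i, ∀ x ∈ Fintype.piFinset B, ∃ s : ℤˣ, ∀ a ∈ B i, ∀ b ∈ B i, (s : ℤ) * a < (s : ℤ) * b →
    f (Function.update x i a) < f (Function.update x i b)

/-- Injective arrays with side lengths at least `N` contain monotone subarrays with side
lengths `n`. -/
def MonoRamsey {d : ℕ} (N n : Fin d → ℕ) : Prop :=
  ∀ (A : Fin d → Finset ℤ) (f : (Fin d → ℤ) → ℝ), (∀ i, N i ≤ (A i).card) →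
    Set.InjOn f (Fintype.piFinset A) → ∃ B ∈ subgrids A n, ∃ s, SignMono B f s

/-- Injective arrays with side lengths at least `N` contain subarrays with side
lengths `n` all of whose lines are monotone. -/
def LineRamsey {d : ℕ} (N n : Fin d → ℕ) : Prop :=
  ∀ (A : Fin d → Finset ℤ) (f : (Fin d → ℤ) → ℝ), (∀ i, N i ≤ (A i).card) →
    Set.InjOn f (Fintype.piFinset A) → ∃ B ∈ subgrids A n, LineMono B f

theorem exists_injective_real (d : ℕ) : ∃ f : (Fin d → ℤ) → ℝ, Function.Injective f := by
  obtain ⟨g, hg⟩ := exists_injective_nat (Fin d → ℤ)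
  exact ⟨fun x => g x, Nat.cast_injective.comp hg⟩

theorem exists_grid_card {d : ℕ} (N : Fin d → ℕ) : ∃ A : Fin d → Finset ℤ, ∀ i, (A i).card = N i :=
  ⟨fun i => (range (N i)).map Nat.castEmbedding, fun i => by simp⟩

/-- Testing the property on a single grid of the exact size gives the inequality. This and its two
analogues keep binomial coefficients positive and families of subgrids non-empty in the pigeonhole
arguments. -/
theorem GridRamsey.le {κ : Type} [Nonempty κ] {d : ℕ} {w m : Fin d → ℕ} (h : GridRamsey κ w m)
    (i : Fin d) : m i ≤ w i := by
  obtain ⟨A, hA⟩ := exists_grid_card w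
  obtain ⟨B, hB, -⟩ := h A (fun _ => Classical.arbitrary κ) fun i => (hA i).ge
  obtain ⟨h1, h2⟩ := mem_subgrids.1 hB i
  exact h2 ▸ hA i ▸ card_le_card h1

theorem MonoRamsey.le {d : ℕ} {N n : Fin d → ℕ} (h : MonoRamsey N n) (i : Fin d) : n i ≤ N i := by
  obtain ⟨A, hA⟩ := exists_grid_card N
  obtain ⟨f, hf⟩ := exists_injective_real d
  obtain ⟨B, hB, -⟩ := h A f (fun i => (hA i).ge) hf.injOn
  obtain ⟨h1, h2⟩ := mem_subgrids.1 hB i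
  exact h2 ▸ hA i ▸ card_le_card h1

theorem LineRamsey.le {d : ℕ} {N n : Fin d → ℕ} (h : LineRamsey N n) (i : Fin d) : n i ≤ N i := by
  obtain ⟨A, hA⟩ := exists_grid_card N
  obtain ⟨f, hf⟩ := exists_injective_real d
  obtain ⟨B, hB, -⟩ := h A f (fun i => (hA i).ge) hf.injOn
  obtain ⟨h1, h2⟩ := mem_subgrids.1 hB i
  exact h2 ▸ hA i ▸ card_le_card h1

theorem monoRamsey_zero (N n : Fin 0 → ℕ) : MonoRamsey N n := fun A _ _ _ =>
  ⟨A, by simp [mem_subgrids], 1, fun i => i.elim0⟩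

theorem lineRamsey_zero (N n : Fin 0 → ℕ) : LineRamsey N n := fun A _ _ _ =>
  ⟨A, by simp [mem_subgrids], fun i => i.elim0⟩

theorem SignMono.subset {d : ℕ} {B G : Fin d → Finset ℤ} {f : (Fin d → ℤ) → ℝ} {s : Fin d → ℤˣ}
    (h : SignMono B f s) (hG : ∀ i, G i ⊆ B i) : SignMono G f s := fun i x hx a ha b hb =>
  h i x (Fintype.piFinset_subset _ _ hG hx) a (hG i ha) b (hG i hb)

theorem injOn_cons {d : ℕ} {A : Fin (d + 1) → Finset ℤ} {f : (Fin (d + 1) → ℤ) → ℝ}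
    (hf : Set.InjOn f (Fintype.piFinset A)) {A' : Fin d → Finset ℤ}
    (hA' : ∀ i, A' i ⊆ A i.succ) {t : ℤ} (ht : t ∈ A 0) :
    Set.InjOn (fun x => f (Fin.cons t x : Fin (d + 1) → ℤ)) (Fintype.piFinset A') := by
  intro x hx y hy hxy
  have h : ∀ x ∈ (Fintype.piFinset A' : Set (Fin d → ℤ)),
      (Fin.cons t x : Fin (d + 1) → ℤ) ∈ (Fintype.piFinset A : Set (Fin (d + 1) → ℤ)) :=
    fun x hx => Finset.mem_coe.2 <|
      cons_mem_piFinset.2 ⟨ht, Fintype.piFinset_subset _ _ hA' (Finset.mem_coe.1 hx)⟩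
  exact (Fin.cons_inj.1 (hf (h x hx) (h y hy) hxy)).2

/-- If the values along a line change in the direction `s`, then they increase in the order
of `s * a`. -/
theorem lt_of_sign_mul_lt {U : Finset ℤ} {v : ℤ → ℝ} {s : ℤˣ}
    (h : ∀ a ∈ U, ∀ b ∈ U, a < b → 0 < ((s : ℤ) : ℝ) * (v b - v a)) {a b : ℤ} (ha : a ∈ U)
    (hb : b ∈ U) (hab : (s : ℤ) * a < (s : ℤ) * b) : v a < v b := by
  rcases Int.units_eq_one_or s with rfl | rfl
  · have := h a ha b hb (by simpa using hab)
    simpa using this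
  · have := h b hb a ha (by simpa using hab)
    simpa using this

theorem sign_mul_sub_pos_of_ne {u v : ℝ} (h : u ≠ v) :
    0 < (((if u < v then 1 else -1 : ℤˣ) : ℤ) : ℝ) * (v - u) := by
  split_ifs with hlt
  · simpa using hlt
  · simpa using lt_of_le_of_ne (not_lt.1 hlt) h.symm

/-- The factor `∏ (R i).choose (w i) * 2 ^ d` pays for slices sharing a monotone subgrid `B` and its
signs. For two such slices, colour `B` by which slice is larger: some subgrid `G` of side lengths
`m` is monochromatic. The relations indexed by the pairs (subgrid, sign) are transitive and cover
all pairs, and their number is the exponent of `k`. A chain for one of them is monotone in the new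
coordinate over `G`, and the old coordinates stay monotone there. -/
theorem MonoRamsey.cons {d : ℕ} {R w m : Fin d → ℕ} (hm : GridRamsey ℤˣ w m)
    (hR : MonoRamsey R w) {N k : ℕ} (hk : 1 ≤ k) 
    (hN : (∏ i, (R i).choose (w i)) * 2 ^ d * k ^ ((∏ i, (w i).choose (m i)) * 2) ≤ N) :
    MonoRamsey (Fin.cons N R : Fin (d + 1) → ℕ) (Fin.cons k m : Fin (d + 1) → ℕ) := by
  classical
  intro A f hA hf
  obtain ⟨A', hA'⟩ := exists_subgrid (Fin.tail A) R fun i => by simpa [Fin.tail] using hA i.succ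
  have hA's : ∀ i, A' i ⊆ A i.succ := fun i => (mem_subgrids.1 hA' i).1
  have hcard : ∀ i, (A' i).card = R i := fun i => (mem_subgrids.1 hA' i).2
  have hslice : ∀ t : ℤ, ∃ Bs : (Fin d → Finset ℤ) × (Fin d → ℤˣ), t ∈ A 0 →
      Bs.1 ∈ subgrids A' w ∧ SignMono Bs.1 (fun x => f (Fin.cons t x : Fin (d + 1) → ℤ)) Bs.2 := by
    intro t
    by_cases ht : t ∈ A 0
    · obtain ⟨B, hB, s, hs⟩ := hR A' (fun x => f (Fin.cons t x : Fin (d + 1) → ℤ))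
        (fun i => (hcard i).ge) (injOn_cons hf hA's ht)
      exact ⟨(B, s), fun _ => ⟨hB, hs⟩⟩
    · exact ⟨(A', 1), fun h => absurd h ht⟩
  choose Bs hBs using hslice
  have hNA : N ≤ (A 0).card := by simpa using hA 0
  have hne : (subgrids A' w ×ˢ (univ : Finset (Fin d → ℤˣ))).Nonempty := by
    obtain ⟨B, hB⟩ := exists_subgrid A' w fun i => (hR.le i).trans (hcard i).ge
    exact ⟨(B, 1), by simp [hB]⟩
  obtain ⟨⟨B, s⟩, hBmem, hfib⟩ := Finset.exists_le_card_fiber_of_mul_le_card_of_maps_to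
    (s := A 0) (t := subgrids A' w ×ˢ (univ : Finset (Fin d → ℤˣ))) (f := Bs)
    (n := k ^ ((∏ i, (w i).choose (m i)) * 2))
    (fun t ht => by simpa using (hBs t ht).1) hne (by
      rw [card_product, card_subgrids, card_univ, Fintype.card_fun, Fintype.card_fin,
        Fintype.card_units_int]
      simp only [hcard]
      exact hN.trans hNA)
  set T := (A 0).filter fun t => Bs t = (B, s) with hTdef
  have hB : B ∈ subgrids A' w := (mem_product.1 hBmem).1
  have hBcard : ∀ i, (B i).card = w i := fun i => (mem_subgrids.1 hB i).2
  have hBA : ∀ i, B i ⊆ A i.succ := fun i => (mem_subgrids.1 hB i).1.trans (hA's i)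
  have hT : ∀ t ∈ T, t ∈ A 0 ∧ SignMono B (fun x => f (Fin.cons t x : Fin (d + 1) → ℤ)) s := by
    intro t ht
    obtain ⟨h0, h1⟩ := mem_filter.1 ht
    have := (hBs t h0).2
    rw [h1] at this
    exact ⟨h0, this⟩
  let C := subgrids B m ×ˢ (univ : Finset ℤˣ)
  have hCcard : C.card = (∏ i, (w i).choose (m i)) * 2 := by
    rw [card_product, card_subgrids, card_univ, Fintype.card_units_int]
    simp only [hBcard]
  obtain ⟨⟨G, e⟩, hGC, U, hUT, hUk, hU⟩ := exists_chain_of_pow_card_le C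
    (by rw [← Finset.card_pos, hCcard]
        exact Nat.mul_pos (Finset.prod_pos fun i _ => Nat.choose_pos (hm.le i)) two_pos)
    (fun c a b => ∀ x ∈ Fintype.piFinset c.1, 0 < ((c.2 : ℤ) : ℝ) *
      (f (Fin.cons b x : Fin (d + 1) → ℤ) - f (Fin.cons a x : Fin (d + 1) → ℤ)))
    (fun c _ x y z h1 h2 p hp => by linarith [h1 p hp, h2 p hp]) T
    (by
      intro a ha b hb hab
      obtain ⟨G, hG, e, he⟩ := hm B (fun x => if f (Fin.cons a x : Fin (d + 1) → ℤ) <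
        f (Fin.cons b x : Fin (d + 1) → ℤ) then 1 else -1) fun i => (hBcard i).ge
      refine ⟨(G, e), mem_product.2 ⟨hG, mem_univ _⟩, fun x hx => ?_⟩
      dsimp only at hx ⊢
      rw [← he x hx]
      refine sign_mul_sub_pos_of_ne fun heq => hab.ne ?_
      have hxA : x ∈ Fintype.piFinset (Fin.tail A) :=
        Fintype.piFinset_subset _ _ hBA (piFinset_subset_of_mem_subgrids hG hx)
      exact (Fin.cons_inj.1 (hf (Finset.mem_coe.2 <| cons_mem_piFinset.2 ⟨(hT a ha).1, hxA⟩)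
        (Finset.mem_coe.2 <| cons_mem_piFinset.2 ⟨(hT b hb).1, hxA⟩) heq)).1)
    hk (by rw [hCcard]; exact hfib)
  have hG : G ∈ subgrids B m := (mem_product.1 hGC).1
  refine ⟨Fin.cons U G, cons_mem_subgrids.2 ⟨⟨fun t ht => (hT t (hUT ht)).1, by simpa using hUk⟩,
    by simpa using subgrids_trans hA' (subgrids_trans hB hG)⟩, Fin.cons e s, ?_⟩
  intro i x hx a ha b hb hab
  rw [← Fin.cons_self_tail x] at hx ⊢
  obtain ⟨h0, h1⟩ := cons_mem_piFinset.1 hx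
  refine Fin.cases ?_ (fun j => ?_) i ha hb hab
  · intro ha hb hab
    simp only [Fin.update_cons_zero]
    exact lt_of_sign_mul_lt (v := fun a => f (Fin.cons a (Fin.tail x) : Fin (d + 1) → ℤ))
      (fun a ha b hb hab => hU a ha b hb hab _ h1) ha hb hab
  · intro ha hb hab
    simp only [← Fin.cons_update]
    exact ((hT _ (hUT h0)).2.subset fun i => (mem_subgrids.1 hG i).1) j (Fin.tail x) h1 a ha b hb hab

/-- Here two slices are compared by their full sign pattern on `B`, a subset `P` of the grid, so
there are `2 ^ ∏ w i` relations. Since the pattern need not be constant, `B` is not shrunk and the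
target sides `w` do not grow from one dimension to the next. -/
theorem LineRamsey.cons {d : ℕ} {R w : Fin d → ℕ} (hR : LineRamsey R w) {N k : ℕ} (hk : 1 ≤ k)
    (hN : (∏ i, (R i).choose (w i)) * k ^ 2 ^ ∏ i, w i ≤ N) :
    LineRamsey (Fin.cons N R : Fin (d + 1) → ℕ) (Fin.cons k w : Fin (d + 1) → ℕ) := by
  classical
  intro A f hA hf
  obtain ⟨A', hA'⟩ := exists_subgrid (Fin.tail A) R fun i => by simpa [Fin.tail] using hA i.succ
  have hA's : ∀ i, A' i ⊆ A i.succ := fun i => (mem_subgrids.1 hA' i).1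
  have hcard : ∀ i, (A' i).card = R i := fun i => (mem_subgrids.1 hA' i).2
  have hslice : ∀ t : ℤ, ∃ B : Fin d → Finset ℤ, t ∈ A 0 →
      B ∈ subgrids A' w ∧ LineMono B (fun x => f (Fin.cons t x : Fin (d + 1) → ℤ)) := by
    intro t
    by_cases ht : t ∈ A 0
    · obtain ⟨B, hB, hs⟩ := hR A' (fun x => f (Fin.cons t x : Fin (d + 1) → ℤ))
        (fun i => (hcard i).ge) (injOn_cons hf hA's ht)
      exact ⟨B, fun _ => ⟨hB, hs⟩⟩
    · exact ⟨A', fun h => absurd h ht⟩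
  choose Bs hBs using hslice
  have hNA : N ≤ (A 0).card := by simpa using hA 0
  obtain ⟨B, hB, hfib⟩ := Finset.exists_le_card_fiber_of_mul_le_card_of_maps_to
    (s := A 0) (t := subgrids A' w) (f := Bs) (n := k ^ 2 ^ ∏ i, w i)
    (fun t ht => (hBs t ht).1) (exists_subgrid A' w fun i => (hR.le i).trans (hcard i).ge) (by
      rw [card_subgrids]
      simp only [hcard]
      exact hN.trans hNA)
  set T := (A 0).filter fun t => Bs t = B with hTdef
  have hBcard : ∀ i, (B i).card = w i := fun i => (mem_subgrids.1 hB i).2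
  have hBA : ∀ i, B i ⊆ A i.succ := fun i => (mem_subgrids.1 hB i).1.trans (hA's i)
  have hT : ∀ t ∈ T, t ∈ A 0 ∧ LineMono B (fun x => f (Fin.cons t x : Fin (d + 1) → ℤ)) := by
    intro t ht
    obtain ⟨h0, h1⟩ := mem_filter.1 ht
    exact ⟨h0, h1 ▸ (hBs t h0).2⟩
  let C := (Fintype.piFinset B).powerset
  obtain ⟨P, -, U, hUT, hUk, hU⟩ := exists_chain_of_pow_card_le C ⟨∅, by simp [C]⟩
    (fun P a b => ∀ x ∈ Fintype.piFinset B, 0 < (((if x ∈ P then 1 else -1 : ℤˣ) : ℤ) : ℝ) *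
      (f (Fin.cons b x : Fin (d + 1) → ℤ) - f (Fin.cons a x : Fin (d + 1) → ℤ)))
    (fun c _ x y z h1 h2 p hp => by linarith [h1 p hp, h2 p hp]) T
    (by
      intro a ha b hb hab
      refine ⟨(Fintype.piFinset B).filter fun x => f (Fin.cons a x : Fin (d + 1) → ℤ) <
        f (Fin.cons b x : Fin (d + 1) → ℤ), by simp [C], fun x hx => ?_⟩
      simp only [mem_filter, hx, true_and]
      refine sign_mul_sub_pos_of_ne fun heq => hab.ne ?_
      have hxA : x ∈ Fintype.piFinset (Fin.tail A) := Fintype.piFinset_subset _ _ hBA hx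
      exact (Fin.cons_inj.1 (hf (Finset.mem_coe.2 <| cons_mem_piFinset.2 ⟨(hT a ha).1, hxA⟩)
        (Finset.mem_coe.2 <| cons_mem_piFinset.2 ⟨(hT b hb).1, hxA⟩) heq)).1)
    hk (by
      rw [card_powerset, Fintype.card_piFinset]
      simp only [hBcard]
      exact hfib)
  refine ⟨Fin.cons U B, cons_mem_subgrids.2 ⟨⟨fun t ht => (hT t (hUT ht)).1, by simpa using hUk⟩,
    by simpa using subgrids_trans hA' hB⟩, ?_⟩
  intro i x hx
  rw [← Fin.cons_self_tail x] at hx ⊢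
  obtain ⟨h0, h1⟩ := cons_mem_piFinset.1 hx
  simp only [Fin.cons_zero, Fin.tail_cons] at h0 h1
  refine Fin.cases ?_ (fun j => ?_) i
  · refine ⟨if Fin.tail x ∈ P then 1 else -1, fun a ha b hb hab => ?_⟩
    simp only [Fin.update_cons_zero]
    exact lt_of_sign_mul_lt (v := fun a => f (Fin.cons a (Fin.tail x) : Fin (d + 1) → ℤ))
      (fun a ha b hb hab => hU a ha b hb hab _ h1) ha hb hab
  · obtain ⟨s, hs⟩ := (hT _ (hUT h0)).2 j (Fin.tail x) h1
    refine ⟨s, fun a ha b hb hab => ?_⟩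
    simp only [← Fin.cons_update]
    exact hs a ha b hb hab

/-- Colour a point by the directions of the `d` lines through it. On a monochromatic subgrid
parallel lines all have the same direction. -/
theorem LineRamsey.monoRamsey {d : ℕ} {N w n : Fin d → ℕ} (hN : LineRamsey N w)
    (hw : GridRamsey (Fin d → ℤˣ) w n) : MonoRamsey N n := by
  classical
  intro A f hA hf
  obtain ⟨B, hB, hline⟩ := hN A f hA hf
  choose s hs using fun i (x : Fintype.piFinset B) => hline i x x.2
  obtain ⟨G, hG, c, hc⟩ := hw B
    (fun x i => if hx : x ∈ Fintype.piFinset B then s i ⟨x, hx⟩ else 1)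
    fun i => (mem_subgrids.1 hB i).2.ge
  refine ⟨G, subgrids_trans hB hG, c, fun i x hx a ha b hb hab => ?_⟩
  have hxB := piFinset_subset_of_mem_subgrids hG hx
  have hGB := (mem_subgrids.1 hG i).1
  refine hs i ⟨x, hxB⟩ a (hGB ha) b (hGB hb) ?_
  have := congrFun (hc x hx) i
  simp only [hxB, dif_pos] at this
  rwa [this]

/-! ### Lexicographic order on grids -/

/-- On the grid `B` the order of the values of `g` is the lexicographic order of the coordinates,
taken in the order `σ`. -/
def LexOn {d : ℕ} (B : Fin d → Finset ℕ) (σ : Equiv.Perm (Fin d)) (g : (Fin d → ℕ) → ℝ) : Prop :=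
  ∀ x ∈ Fintype.piFinset B, ∀ y ∈ Fintype.piFinset B,
    (g x < g y ↔ toLex (fun i => x (σ i)) < toLex (fun i => y (σ i)))

/-- Arrays on `{0, …, N - 1}^d` that increase strictly in every coordinate contain
lexicographically ordered subarrays of side length `n`. -/
def MonoLexRamsey (d N n : ℕ) : Prop :=
  ∀ g : (Fin d → ℕ) → ℝ, StrictMonoOn g {x | ∀ i, x i < N} →
    ∃ B ∈ subgrids (fun _ : Fin d => range N) (fun _ => n), ∃ σ, LexOn B σ g

theorem toLex_lt_toLex_iff {d : ℕ} {α : Type*} [LinearOrder α] {a b : Fin d → α} :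
    toLex a < toLex b ↔ ∃ i, (∀ j < i, a j = b j) ∧ a i < b i := Iff.rfl

theorem toLex_strictMonoOn_comp_lt_iff {d : ℕ} {α β : Type*} [LinearOrder α] [LinearOrder β]
    {B : Fin d → Set α} {e : Fin d → α → β} (he : ∀ i, StrictMonoOn (e i) (B i)) {a b : Fin d → α}
    (ha : ∀ i, a i ∈ B i) (hb : ∀ i, b i ∈ B i) (σ : Equiv.Perm (Fin d)) :
    toLex (fun i => e (σ i) (a (σ i))) < toLex (fun i => e (σ i) (b (σ i))) ↔
      toLex (fun i => a (σ i)) < toLex (fun i => b (σ i)) := by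
  simp only [toLex_lt_toLex_iff]
  refine exists_congr fun i => and_congr (forall₂_congr fun j _ => ?_) ?_
  · exact (he (σ j)).injOn.eq_iff (ha _) (hb _)
  · exact (he (σ i)).lt_iff_lt (ha _) (hb _)

/-- Transports an order along coordinatewise reparametrisations `e`. The map `φ` is the scale on
which the image is compared: the identity for translates, multiplication by a sign for reflected
axes. -/
theorem LexOn.image {d : ℕ} {α β : Type*} [DecidableEq α] [LinearOrder β]
    {B : Fin d → Finset ℕ} {σ : Equiv.Perm (Fin d)} {g : (Fin d → α) → ℝ} {e : Fin d → ℕ → α}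
    {φ : Fin d → α → β} (he : ∀ i, StrictMonoOn (fun k => φ i (e i k)) (B i))
    (h : LexOn B σ fun x => g fun i => e i (x i)) :
    ∀ x ∈ Fintype.piFinset fun i => (B i).image (e i),
    ∀ y ∈ Fintype.piFinset fun i => (B i).image (e i),
      (g x < g y ↔ toLex (fun i => φ (σ i) (x (σ i))) < toLex (fun i => φ (σ i) (y (σ i)))) := by
  intro x hx y hy
  simp only [Fintype.mem_piFinset, mem_image] at hx hy
  choose x' hx' hxe using hx
  choose y' hy' hye using hy
  obtain rfl : (fun i => e i (x' i)) = x := funext hxe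
  obtain rfl : (fun i => e i (y' i)) = y := funext hye
  rw [h x' (Fintype.mem_piFinset.2 hx') y' (Fintype.mem_piFinset.2 hy')]
  exact (toLex_strictMonoOn_comp_lt_iff he (a := x') (b := y')
    (fun i => mem_coe.2 (hx' i)) (fun i => mem_coe.2 (hy' i)) σ).symm

theorem insertNth_mem_piFinset {d : ℕ} {α : Type*} {i : Fin (d + 1)} {T : Finset α}
    {B : Fin d → Finset α} {t : α} {x : Fin d → α} :
    (i.insertNth t x : Fin (d + 1) → α) ∈
      Fintype.piFinset (i.insertNth T B : Fin (d + 1) → Finset α) ↔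
      t ∈ T ∧ x ∈ Fintype.piFinset B := by
  simp only [Fintype.mem_piFinset]
  rw [Fin.forall_iff_succAbove i]
  simp

theorem insertNth_mem_subgrids {d : ℕ} {α : Type*} {i : Fin (d + 1)} {A : Finset α}
    {U : Finset α} {B : Fin d → Finset α} {n : ℕ} (hU : U ⊆ A) (hUn : U.card = n)
    (hB : B ∈ subgrids (fun _ => A) fun _ => n) :
    (i.insertNth U B : Fin (d + 1) → Finset α) ∈ subgrids (fun _ => A) fun _ => n := by
  rw [mem_subgrids] at *
  rw [Fin.forall_iff_succAbove i]
  simpa using ⟨⟨hU, hUn⟩, hB⟩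

/-- The order of coordinates that starts with `i` and continues with `σ`. -/
noncomputable def consPerm {d : ℕ} (i : Fin (d + 1)) (σ : Equiv.Perm (Fin d)) :
    Equiv.Perm (Fin (d + 1)) :=
  Equiv.ofBijective (Fin.cons i fun k => i.succAbove (σ k) : Fin (d + 1) → Fin (d + 1)) <|
    Finite.injective_iff_bijective.1 <| Fin.cons_injective_iff.2
      ⟨by rintro ⟨k, hk⟩; exact Fin.succAbove_ne _ _ hk,
        (Fin.succAbove_right_injective).comp σ.injective⟩

theorem consPerm_zero {d : ℕ} (i : Fin (d + 1)) (σ : Equiv.Perm (Fin d)) :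
    consPerm i σ 0 = i := rfl

theorem consPerm_succ {d : ℕ} (i : Fin (d + 1)) (σ : Equiv.Perm (Fin d)) (k : Fin d) :
    consPerm i σ k.succ = i.succAbove (σ k) := rfl

theorem lexOn_insertNth {d : ℕ} {g : (Fin (d + 1) → ℕ) → ℝ} {i : Fin (d + 1)} {T : Finset ℕ}
    {B : Fin d → Finset ℕ} {σ : Equiv.Perm (Fin d)}
    (hdom : ∀ t ∈ T, ∀ t' ∈ T, t < t' → ∀ x ∈ Fintype.piFinset B, ∀ y ∈ Fintype.piFinset B,
      g (i.insertNth t x) < g (i.insertNth t' y))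
    (hslice : ∀ t ∈ T, LexOn B σ fun x => g (i.insertNth t x)) :
    LexOn (i.insertNth T B : Fin (d + 1) → Finset ℕ) (consPerm i σ) g := by
  intro x hx y hy
  rw [← Fin.insertNth_self_removeNth i x] at hx ⊢
  rw [← Fin.insertNth_self_removeNth i y] at hy ⊢
  generalize x i = a at *
  generalize i.removeNth x = x at *
  generalize y i = b at *
  generalize i.removeNth y = y at *
  obtain ⟨ha, hx'⟩ := insertNth_mem_piFinset.1 hx
  obtain ⟨hb, hy'⟩ := insertNth_mem_piFinset.1 hy
  rw [toLex_lt_toLex_iff, Fin.exists_fin_succ]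
  simp only [Fin.forall_fin_succ, consPerm_zero, consPerm_succ, Fin.insertNth_apply_same,
    Fin.insertNth_apply_succAbove, Fin.not_lt_zero, Fin.succ_pos, Fin.succ_lt_succ_iff,
    false_imp_iff, true_imp_iff, implies_true, true_and]
  rcases lt_trichotomy a b with h | rfl | h
  · exact iff_of_true (hdom a ha b hb h x hx' y hy') (Or.inl h)
  · rw [hslice a ha x hx' y hy', toLex_lt_toLex_iff]
    simp
  · refine iff_of_false (hdom b hb a ha h y hy' x hx').not_gt ?_
    rintro (h' | ⟨k, ⟨h', -⟩, -⟩) <;> omega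

/-! ### Dominating coordinates and lexicographic subarrays of increasing arrays -/

/-- Passing from `P κ k` to `P κ (k + 1)` raises every coordinate by `m`, except one coordinate `i`
that wraps around and falls by `d * m`. As `k` runs through a cycle, `g` cannot increase at every
step. At a descent, the top corner of a box at level `κ i` has value at most that of the bottom
corner of the same box one level higher. Monotonicity extends this to all points of the box and all
higher levels. -/
theorem exists_dominating_coordinate {d m M : ℕ} (hd : 1 ≤ d) (hM : 1 ≤ M)
    {g : (Fin (d + 1) → ℕ) → ℝ}
    (hg : StrictMonoOn g {x | ∀ i, x i < (d + 1) * M * (d * m) + 1}) :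
    ∃ (i : Fin (d + 1)) (lo : Fin d → ℕ) (Q : Finset ℕ), Q ⊆ range ((d + 1) * M) ∧ Q.card = M ∧
      (∀ j, lo j + m ≤ (d + 1) * M * (d * m)) ∧
      ∀ q ∈ Q, ∀ q' ∈ Q, q < q' → ∀ x y : Fin d → ℕ, (∀ j, x j ∈ Ico (lo j) (lo j + m)) →
        (∀ j, y j ∈ Ico (lo j) (lo j + m)) →
        g (i.insertNth (q * (d * m)) x) < g (i.insertNth (q' * (d * m)) y) := by
  classical
  set K := (d + 1) * M with hK
  have hKpos : 0 < K := by positivity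
  let P (κ : Fin (d + 1) → Fin K) (k : Fin (d + 1)) : Fin (d + 1) → ℕ :=
    fun i => κ i * (d * m) + (i + k).val * m
  have hblock : ∀ (a : Fin K) (v : ℕ), v ≤ d → a.val * (d * m) + v * m ≤ K * (d * m) := by
    intro a v hv
    calc a.val * (d * m) + v * m ≤ a.val * (d * m) + d * m := by gcongr
      _ = (a.val + 1) * (d * m) := by ring
      _ ≤ K * (d * m) := Nat.mul_le_mul_right _ a.2
  have hP : ∀ κ k, P κ k ∈ {x : Fin (d + 1) → ℕ | ∀ i, x i < K * (d * m) + 1} := fun κ k i =>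
    Nat.lt_succ_of_le (hblock _ _ (Nat.le_of_lt_succ (i + k).2))
  have hmin : ∀ κ, ∃ k, g (P κ (k + 1)) ≤ g (P κ k) := by
    intro κ
    obtain ⟨k, hk⟩ := Finite.exists_min fun k => g (P κ k)
    -- The step into a point of the cycle where `g` is minimal is a descent.
    exact ⟨k - 1, by simpa using hk (k - 1)⟩
  choose k hk using hmin
  -- There are `K ^ (d + 1) = (d + 1) * K ^ d * M` choices of `κ`, so `M` of them share the descent
  -- and all coordinates but the wrapping one.
  obtain ⟨⟨k₀, ρ⟩, -, hfib⟩ := Finset.exists_le_card_fiber_of_mul_le_card_of_maps_to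
    (s := (univ : Finset (Fin (d + 1) → Fin K)))
    (t := (univ : Finset (Fin (d + 1) × (Fin d → Fin K))))
    (f := fun κ => (k κ, (Fin.last d - k κ).removeNth κ)) (n := M)
    (fun _ _ => mem_univ _) ⟨(0, fun _ => ⟨0, hKpos⟩), mem_univ _⟩ (by
      simp only [card_univ, Fintype.card_prod, Fintype.card_fun, Fintype.card_fin]
      rw [pow_succ, mul_right_comm, mul_comm])
  set F := (univ : Finset (Fin (d + 1) → Fin K)).filter
    fun κ => (k κ, (Fin.last d - k κ).removeNth κ) = (k₀, ρ)
  set i := Fin.last d - k₀ with hi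
  have hF : ∀ κ ∈ F, k κ = k₀ ∧ i.removeNth κ = ρ := by
    intro κ hκ
    obtain ⟨h1, h2⟩ := Prod.ext_iff.1 (mem_filter.1 hκ).2
    dsimp only at h1 h2
    rw [h1] at h2
    exact ⟨h1, h2⟩
  have hcard : (F.image fun κ => (κ i).val).card = F.card := by
    refine card_image_of_injOn fun κ hκ κ' hκ' h => ?_
    rw [← Fin.insertNth_self_removeNth i κ, ← Fin.insertNth_self_removeNth i κ',
      (hF κ hκ).2, (hF κ' hκ').2, Fin.ext h]
  obtain ⟨Q, hQ, hQM⟩ := exists_subset_card_eq (hfib.trans hcard.ge)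
  have hne : ∀ j, i.succAbove j + k₀ < Fin.last d := by
    intro j
    exact lt_of_le_of_ne (Fin.le_last _) fun h =>
      Fin.succAbove_ne i j (eq_sub_of_add_eq h)
  have hval : ∀ j, (i.succAbove j + (k₀ + 1)).val = (i.succAbove j + k₀).val + 1 := fun j => by
    rw [← add_assoc, Fin.val_add_one_of_lt (hne j)]
  have hlt : ∀ j, (i.succAbove j + k₀).val + 1 ≤ d := fun j => hne j
  have hlo : ∀ j, (ρ j).val * (d * m) + (i.succAbove j + k₀).val * m + m ≤ K * (d * m) := by
    intro j
    have := hblock (ρ j) _ (hlt j)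
    linarith
  refine ⟨i, fun j => ρ j * (d * m) + (i.succAbove j + k₀).val * m, Q, ?_, hQM, hlo, ?_⟩
  · intro q hq
    obtain ⟨κ, -, rfl⟩ := mem_image.1 (hQ hq)
    exact mem_range.2 (κ i).2
  · intro q hq q' hq' hqq x y hx hy
    obtain ⟨κ, hκ, rfl⟩ := mem_image.1 (hQ hq)
    have hq'K : q' < K := by
      obtain ⟨κ', -, rfl⟩ := mem_image.1 (hQ hq')
      exact (κ' i).2
    obtain ⟨hκk, hκρ⟩ := hF κ hκ
    have hκj : ∀ j, κ (i.succAbove j) = ρ j := fun j => congrFun hκρ j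
    have hbox : ∀ (q : ℕ) (x : Fin d → ℕ), q ≤ K → (∀ j, x j ∈ Ico
        ((ρ j).val * (d * m) + (i.succAbove j + k₀).val * m)
        ((ρ j).val * (d * m) + (i.succAbove j + k₀).val * m + m)) →
        (i.insertNth (q * (d * m)) x : Fin (d + 1) → ℕ) ∈
          {x : Fin (d + 1) → ℕ | ∀ i, x i < K * (d * m) + 1} := by
      intro q x hq hx
      simp only [Set.mem_ofPred_eq]
      rw [Fin.forall_iff_succAbove i]
      simp only [Fin.insertNth_apply_same, Fin.insertNth_apply_succAbove]
      refine ⟨Nat.lt_succ_of_le (Nat.mul_le_mul_right _ hq), fun j => ?_⟩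
      have h1 := (mem_Ico.1 (hx j)).2
      have h2 := hlo j
      omega
    have hupper : (i.insertNth ((κ i).val * (d * m)) x : Fin (d + 1) → ℕ) < P κ (k₀ + 1) := by
      have hj : ∀ j, x j < P κ (k₀ + 1) (i.succAbove j) := by
        intro j
        have h1 := (mem_Ico.1 (hx j)).2
        simp only [P, hval, hκj]
        linarith
      rw [Pi.lt_def]
      -- Coordinate `i` is equal on both sides, so strictness comes from another coordinate; this is
      -- where `1 ≤ d` enters.
      refine ⟨?_, i.succAbove ⟨0, hd⟩, by simpa using hj ⟨0, hd⟩⟩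
      rw [Pi.le_def, Fin.forall_iff_succAbove i]
      refine ⟨by simp [P], fun j => by simpa using (hj j).le⟩
    have hlower : P κ k₀ ≤ (i.insertNth (q' * (d * m)) y : Fin (d + 1) → ℕ) := by
      rw [Pi.le_def, Fin.forall_iff_succAbove i]
      simp only [Fin.insertNth_apply_same, Fin.insertNth_apply_succAbove]
      refine ⟨?_, fun j => ?_⟩
      · simp only [P, hi, sub_add_cancel, Fin.val_last]
        rw [← Nat.succ_mul]
        exact Nat.mul_le_mul_right _ hqq
      · simp only [P, hκj]
        exact (mem_Ico.1 (hy j)).1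
    calc g (i.insertNth ((κ i).val * (d * m)) x) < g (P κ (k₀ + 1)) :=
          hg (hbox _ x (κ i).2.le hx) (hP _ _) hupper
      _ ≤ g (P κ k₀) := by have := hk κ; rwa [hκk] at this
      _ ≤ g (i.insertNth (q' * (d * m)) y) := hg.monotoneOn (hP _ _) (hbox _ y hq'K.le hy) hlower

theorem monoLexRamsey_one (n : ℕ) : MonoLexRamsey 1 n n := by
  intro g hg
  refine ⟨fun _ => range n, by simp [mem_subgrids], 1, fun x hx y hy => ?_⟩
  simp only [Fintype.mem_piFinset, mem_range] at hx hy
  have hline : StrictMonoOn (fun t : ℕ => g fun _ => t) (Set.Iio n) := fun a ha b hb hab =>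
    hg (fun _ => ha) (fun _ => hb) (Pi.lt_def.2 ⟨fun _ => hab.le, 0, hab⟩)
  have hconst : ∀ x : Fin 1 → ℕ, (fun _ => x 0) = x := fun x =>
    funext fun j => by rw [Subsingleton.elim j 0]
  have h := hline.lt_iff_lt (hx 0) (hy 0)
  simp only [hconst] at h
  rw [h, toLex_lt_toLex_iff]
  simp [Fin.exists_fin_one]

theorem StrictMonoOn.insertNth {d N m t : ℕ} {g : (Fin (d + 1) → ℕ) → ℝ}
    (hg : StrictMonoOn g {x | ∀ i, x i < N}) (i : Fin (d + 1)) {lo : Fin d → ℕ} (ht : t < N)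
    (hlo : ∀ j, lo j + m ≤ N) :
    StrictMonoOn (fun x : Fin d → ℕ => g (i.insertNth t fun j => lo j + x j)) {x | ∀ j, x j < m} := by
  have hbox : ∀ x ∈ {x : Fin d → ℕ | ∀ j, x j < m},
      (i.insertNth t (fun j => lo j + x j) : Fin (d + 1) → ℕ) ∈
        {x : Fin (d + 1) → ℕ | ∀ i, x i < N} := by
    intro x hx
    simp only [Set.mem_ofPred_eq]
    rw [Fin.forall_iff_succAbove i]
    simp only [Fin.insertNth_apply_same, Fin.insertNth_apply_succAbove]
    refine ⟨ht, fun j => ?_⟩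
    have := hx j
    have := hlo j
    omega
  intro x hx y hy hxy
  refine hg (hbox x hx) (hbox y hy) ?_
  obtain ⟨hle, j, hj⟩ := Pi.lt_def.1 hxy
  rw [Pi.lt_def]
  refine ⟨?_, i.succAbove j, by simpa using hj⟩
  rw [Pi.le_def, Fin.forall_iff_succAbove i]
  simpa [Pi.le_def] using hle

/-- The translate of a grid. -/
def shift {d : ℕ} (lo : Fin d → ℕ) (B : Fin d → Finset ℕ) : Fin d → Finset ℕ :=
  fun j => (B j).image (lo j + ·)

theorem LexOn.shift {d : ℕ} {lo : Fin d → ℕ} {B : Fin d → Finset ℕ} {σ : Equiv.Perm (Fin d)}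
    {g : (Fin d → ℕ) → ℝ} (h : LexOn B σ fun x => g fun j => lo j + x j) :
    LexOn (shift lo B) σ g :=
  LexOn.image (φ := fun _ => id) (e := fun j k => lo j + k)
    (fun _ _ _ _ _ h => Nat.add_lt_add_left h _) h

theorem shift_mem_subgrids {d m n : ℕ} {lo : Fin d → ℕ} {B : Fin d → Finset ℕ}
    (hB : B ∈ subgrids (fun _ => range m) fun _ => n) :
    shift lo B ∈ subgrids (fun j => Ico (lo j) (lo j + m)) fun _ => n := by
  rw [mem_subgrids] at *
  refine fun j => ⟨fun t ht => ?_, ?_⟩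
  · obtain ⟨k, hk, rfl⟩ := mem_image.1 ht
    have := mem_range.1 ((hB j).1 hk)
    exact mem_Ico.2 ⟨by omega, by omega⟩
  · rw [shift, card_image_of_injective _ (add_right_injective _), (hB j).2]

/-- Slices along a dominating coordinate that are lexicographically ordered in the same way
combine to a lexicographically ordered array. -/
theorem lexOn_of_dominating {d m n N D : ℕ} {g : (Fin (d + 1) → ℕ) → ℝ} {i : Fin (d + 1)}
    {lo : Fin d → ℕ} {U : Finset ℕ} (hD : 0 < D) (hlo : ∀ j, lo j + m ≤ N)
    (hUN : ∀ q ∈ U, q * D < N) (hUn : U.card = n)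
    (hdom : ∀ q ∈ U, ∀ q' ∈ U, q < q' → ∀ x y : Fin d → ℕ, (∀ j, x j ∈ Ico (lo j) (lo j + m)) →
        (∀ j, y j ∈ Ico (lo j) (lo j + m)) →
        g (i.insertNth (q * D) x) < g (i.insertNth (q' * D) y))
    {B : Fin d → Finset ℕ} (hB : B ∈ subgrids (fun _ => range m) fun _ => n)
    {σ : Equiv.Perm (Fin d)}
    (hlex : ∀ q ∈ U, LexOn B σ fun x => g (i.insertNth (q * D) fun j => lo j + x j)) :
    (i.insertNth (U.image (· * D)) (shift lo B) : Fin (d + 1) → Finset ℕ) ∈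
      subgrids (fun _ => range N) (fun _ => n) ∧
    LexOn (i.insertNth (U.image (· * D)) (shift lo B)) (consPerm i σ) g := by
  have hB' := shift_mem_subgrids (lo := lo) hB
  have hmem : ∀ x ∈ Fintype.piFinset (shift lo B), ∀ j, x j ∈ Ico (lo j) (lo j + m) :=
    fun x hx j => (mem_subgrids.1 hB' j).1 (Fintype.mem_piFinset.1 hx j)
  refine ⟨insertNth_mem_subgrids ?_ ?_ ?_, lexOn_insertNth ?_ ?_⟩
  · intro t ht
    obtain ⟨q, hq, rfl⟩ := mem_image.1 ht
    exact mem_range.2 (hUN q hq)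
  · rw [card_image_of_injective _ (fun a b h => Nat.eq_of_mul_eq_mul_right hD h), hUn]
  · rw [mem_subgrids] at *
    refine fun j => ⟨fun t ht => ?_, (hB' j).2⟩
    have := mem_Ico.1 ((hB' j).1 ht)
    have := hlo j
    exact mem_range.2 (by omega)
  · intro t ht t' ht' htt x hx y hy
    obtain ⟨q, hq, rfl⟩ := mem_image.1 ht
    obtain ⟨q', hq', rfl⟩ := mem_image.1 ht'
    exact hdom q hq q' hq' (lt_of_mul_lt_mul_right htt (Nat.zero_le _)) x y (hmem x hx) (hmem y hy)
  · intro t ht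
    obtain ⟨q, hq, rfl⟩ := mem_image.1 ht
    exact (hlex q hq).shift

/-- Fix the dominating coordinate. Each of the `m.choose n ^ d * d.factorial * n` slices contains an
ordered grid inside the box, and `n` slices agree on both the grid and its order of coordinates. -/
theorem MonoLexRamsey.succ {d m n : ℕ} (hd : 1 ≤ d) (hn : 1 ≤ n) (hnm : n ≤ m)
    (h : MonoLexRamsey d m n) :
    MonoLexRamsey (d + 1) ((d + 1) * (m.choose n ^ d * d.factorial * n) * (d * m) + 1) n := by
  classical
  intro g hg
  have hc := Nat.choose_pos hnm
  have hf := d.factorial_pos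
  obtain ⟨i, lo, Q, hQK, hQ, hlo, hdom⟩ := exists_dominating_coordinate hd
    (Nat.mul_pos (Nat.mul_pos (pow_pos hc d) hf) hn) hg
  have hQN : ∀ q ∈ Q, q * (d * m) <
      (d + 1) * (m.choose n ^ d * d.factorial * n) * (d * m) + 1 := fun q hq =>
    Nat.lt_succ_of_le (Nat.mul_le_mul_right _ (mem_range.1 (hQK hq)).le)
  have hslice : ∀ q : ℕ, ∃ p : (Fin d → Finset ℕ) × Equiv.Perm (Fin d), q ∈ Q →
      p.1 ∈ subgrids (fun _ => range m) (fun _ => n) ∧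
      LexOn p.1 p.2 fun x => g (i.insertNth (q * (d * m)) fun j => lo j + x j) := by
    intro q
    by_cases hq : q ∈ Q
    · obtain ⟨B, hB, σ, hσ⟩ := h _ (hg.insertNth i (hQN q hq) fun j => (hlo j).trans (Nat.le_succ _))
      exact ⟨(B, σ), fun _ => ⟨hB, hσ⟩⟩
    · exact ⟨(fun _ => ∅, 1), fun h => absurd h hq⟩
  choose p hp using hslice
  obtain ⟨⟨B, σ⟩, hBσ, hfib⟩ := Finset.exists_le_card_fiber_of_mul_le_card_of_maps_to
    (s := Q) (t := subgrids (fun _ : Fin d => range m) (fun _ => n) ×ˢ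
      (univ : Finset (Equiv.Perm (Fin d)))) (f := p) (n := n)
    (fun q hq => mem_product.2 ⟨(hp q hq).1, mem_univ _⟩)
    (by
      obtain ⟨B, hB⟩ := exists_subgrid (fun _ : Fin d => range m) (fun _ => n) (by simp [hnm])
      exact ⟨(B, 1), mem_product.2 ⟨hB, mem_univ _⟩⟩)
    (by
      rw [card_product, card_subgrids, card_univ, Fintype.card_perm, hQ]
      simp)
  obtain ⟨U, hU, hUn⟩ := exists_subset_card_eq hfib
  have hUQ : ∀ q ∈ U, q ∈ Q ∧ p q = (B, σ) := fun q hq => by simpa using hU hq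
  obtain ⟨h1, h2⟩ := lexOn_of_dominating (Nat.mul_pos hd (hn.trans hnm))
    (fun j => (hlo j).trans (Nat.le_succ _)) (fun q hq => hQN q (hUQ q hq).1) hUn
    (fun q hq q' hq' => hdom q (hUQ q hq).1 q' (hUQ q' hq').1) (mem_product.1 hBσ).1
    (σ := σ) fun q hq => by
      have := (hp q (hUQ q hq).1).2
      rwa [(hUQ q hq).2] at this
  exact ⟨_, h1, _, h2⟩

theorem monoLexRamsey_two {n : ℕ} (hn : 1 ≤ n) : MonoLexRamsey 2 (2 * n ^ 2 + 1) n := by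
  -- With `m = n` and one remaining coordinate there is a single outcome per slice, so the
  -- pigeonhole costs nothing.
  convert (monoLexRamsey_one n).succ le_rfl hn le_rfl using 1
  simp
  ring

/-- An efficient version of `MonoLexRamsey.succ` for three coordinates: all `n`-subsets of the
positions found in a slice are counted. -/
theorem monoLexRamsey_three {n a M : ℕ} (hn : 1 ≤ n) (hna : n ≤ a)
    (hM : 2 * (2 * a * n + 1) * (2 * a).choose n * n ≤ M * a.choose n) :
    MonoLexRamsey 3 (3 * M * (2 * (2 * a * n + 1)) + 1) n := by
  classical
  intro g hg
  -- The side needed to find, in a two-dimensional slice, `a` dominating levels over an interval of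
  -- length `n`.
  set m := 2 * a * n + 1 with hm
  have hc : 0 < (2 * a).choose n := Nat.choose_pos (by omega)
  have hM1 : 1 ≤ M := by
    by_contra h
    have : M = 0 := by omega
    subst this
    have : 0 < 2 * m * (2 * a).choose n * n := by positivity
    omega
  obtain ⟨i, lo, Q, hQK, hQ, hlo, hdom⟩ := exists_dominating_coordinate (d := 2) (m := m)
    (by norm_num) hM1 hg
  have hQN : ∀ q ∈ Q, q * (2 * m) < 3 * M * (2 * m) + 1 := fun q hq =>
    Nat.lt_succ_of_le (Nat.mul_le_mul_right _ (mem_range.1 (hQK hq)).le)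
  have hslice : ∀ q : ℕ, ∃ (i' : Fin 2) (l : ℕ) (R : Finset ℕ), q ∈ Q →
      R ⊆ range (2 * a) ∧ R.card = a ∧ l < m ∧ ∀ U ⊆ R, U.card = n →
        (i'.insertNth (U.image (· * n)) (shift (fun _ => l) fun _ => range n) :
          Fin 2 → Finset ℕ) ∈ subgrids (fun _ => range m) (fun _ => n) ∧
        LexOn (i'.insertNth (U.image (· * n)) (shift (fun _ => l) fun _ => range n))
          (consPerm i' 1) fun x => g (i.insertNth (q * (2 * m)) fun j => lo j + x j) := by
    intro q
    by_cases hq : q ∈ Q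
    · have hg' := hg.insertNth (m := m) i (hQN q hq) fun j => (hlo j).trans (Nat.le_succ _)
      set g' := fun x : Fin 2 → ℕ => g (i.insertNth (q * (2 * m)) fun j => lo j + x j)
      obtain ⟨i', lo', R, hRK, hR, hlo', hdom'⟩ := exists_dominating_coordinate (d := 1) (m := n)
        (M := a) (g := g') le_rfl (hn.trans hna) (by simpa [hm] using hg')
      simp only [one_mul, Nat.reduceAdd] at hRK hlo' hdom'
      obtain ⟨l, rfl⟩ : ∃ l, lo' = fun _ => l := ⟨lo' 0, funext fun j => by rw [Subsingleton.elim j 0]⟩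
      refine ⟨i', l, R, fun _ => ⟨hRK, hR, ?_, fun U hU hUn => ?_⟩⟩
      · have : l + n ≤ 2 * a * n := hlo' 0
        omega
      · have hUm : ∀ q ∈ U, q * n < m := fun q hq =>
          Nat.lt_succ_of_le (Nat.mul_le_mul_right _ (mem_range.1 (hRK (hU hq))).le)
        have hlo'm : ∀ j : Fin 1, l + n ≤ m := fun j => (hlo' 0).trans (Nat.le_succ _)
        refine lexOn_of_dominating hn hlo'm hUm hUn
          (fun q hq q' hq' => hdom' q (hU hq) q' (hU hq')) (by simp [mem_subgrids])
          fun q hq => ?_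
        obtain ⟨B, hB, σ, hσ⟩ := monoLexRamsey_one n _ (hg'.insertNth i' (hUm q hq) hlo'm)
        obtain rfl : B = fun _ => range n := funext fun j => by
          obtain ⟨h1, h2⟩ := mem_subgrids.1 hB j
          exact eq_of_subset_of_card_le h1 (by simp [h2])
        rwa [Subsingleton.elim σ 1] at hσ
    · exact ⟨0, 0, ∅, fun h => absurd h hq⟩
  choose i' l R hslice using hslice
  -- Double counting of pairs (slice, `n`-subset of its `a` good levels), sorted by dominating
  -- coordinate, offset and subset. The loss is governed by the ratio `(2 * a).choose n / a.choose
  -- n` instead of a full binomial coefficient.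
  obtain ⟨⟨i₀, l₀, U⟩, hmem, hfib⟩ := Finset.exists_le_card_fiber_of_mul_le_card_of_maps_to
    (s := Q.sigma fun q => powersetCard n (R q))
    (t := (univ : Finset (Fin 2)) ×ˢ range m ×ˢ powersetCard n (range (2 * a)))
    (f := fun p => (i' p.1, l p.1, p.2)) (n := n)
    (fun p hp => by
      obtain ⟨h1, h2⟩ := mem_sigma.1 hp
      obtain ⟨h3, h4, h5, h6⟩ := hslice p.1 h1
      obtain ⟨h7, h8⟩ := mem_powersetCard.1 h2
      exact mem_product.2 ⟨mem_univ _, mem_product.2 ⟨mem_range.2 h5,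
        mem_powersetCard.2 ⟨h7.trans h3, h8⟩⟩⟩)
    (by
      rw [← card_pos]
      simp only [card_product, card_univ, Fintype.card_fin, card_range, card_powersetCard]
      positivity)
    (by
      rw [card_sigma, sum_congr rfl fun q hq => by
        rw [card_powersetCard, (hslice q hq).2.1]]
      simp only [card_product, card_univ, Fintype.card_fin, card_range, card_powersetCard,
        sum_const, smul_eq_mul, hQ]
      rwa [← mul_assoc])
  set F := (Q.sigma fun q => powersetCard n (R q)).filter
    fun p => (i' p.1, l p.1, p.2) = (i₀, l₀, U)
  have hF : ∀ p ∈ F, p.1 ∈ Q ∧ U ⊆ R p.1 ∧ U.card = n ∧ i' p.1 = i₀ ∧ l p.1 = l₀ ∧ p.2 = U := by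
    intro p hp
    obtain ⟨h1, h2⟩ := mem_filter.1 hp
    obtain ⟨h3, h4⟩ := mem_sigma.1 h1
    simp only [Prod.ext_iff] at h2
    obtain ⟨h5, h6⟩ := mem_powersetCard.1 h4
    obtain ⟨h7, h8, h9⟩ := h2
    exact ⟨h3, h9 ▸ h5, h9 ▸ h6, h7, h8, h9⟩
  have hcard : (F.image Sigma.fst).card = F.card := by
    refine card_image_of_injOn fun p hp p' hp' h => ?_
    have h1 := (hF p hp).2.2.2.2.2
    have h2 := (hF p' hp').2.2.2.2.2
    exact Sigma.ext h (heq_of_eq (h1.trans h2.symm))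
  obtain ⟨V, hV, hVn⟩ := exists_subset_card_eq (hfib.trans hcard.ge)
  have hVQ : ∀ q ∈ V, q ∈ Q ∧ U ⊆ R q ∧ U.card = n ∧ i' q = i₀ ∧ l q = l₀ := by
    intro q hq
    obtain ⟨p, hp, rfl⟩ := mem_image.1 (hV hq)
    obtain ⟨h1, h2, h3, h4, h5, -⟩ := hF p hp
    exact ⟨h1, h2, h3, h4, h5⟩
  have hVlex : ∀ q ∈ V, _ := fun q hq =>
    (hslice q (hVQ q hq).1).2.2.2 U (hVQ q hq).2.1 (hVQ q hq).2.2.1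
  obtain ⟨q₀, hq₀⟩ : V.Nonempty := by rw [← card_pos]; omega
  obtain ⟨h1, h2⟩ := lexOn_of_dominating (g := g) (i := i) (lo := lo) (D := 2 * m) (m := m)
    (N := 3 * M * (2 * m) + 1) (by omega)
    (fun j => (hlo j).trans (Nat.le_succ _)) (fun q hq => hQN q (hVQ q hq).1) hVn
    (fun q hq q' hq' => hdom q (hVQ q hq).1 q' (hVQ q' hq').1)
    (hVlex q₀ hq₀).1 (σ := consPerm i₀ 1) fun q hq => by
      have := (hVlex q hq).2
      rw [(hVQ q hq).2.2.2.1, (hVQ q hq).2.2.2.2] at this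
      rw [(hVQ q₀ hq₀).2.2.2.1, (hVQ q₀ hq₀).2.2.2.2]
      exact this
  exact ⟨_, h1, _, h2⟩

/-! ### From arbitrary arrays to increasing arrays -/

theorem grid_eq_coe_piFinset {d : ℕ} (A : Fin d → Finset ℤ) :
    grid A = (Fintype.piFinset A : Set (Fin d → ℤ)) := by
  ext x
  simp [grid]

theorem SignMono.le_of_forall_le {d : ℕ} {B : Fin d → Finset ℤ} {f : (Fin d → ℤ) → ℝ}
    {s : Fin d → ℤˣ} (h : SignMono B f s) {x y : Fin d → ℤ} (hx : x ∈ Fintype.piFinset B)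
    (hy : y ∈ Fintype.piFinset B) (hxy : ∀ i, (s i : ℤ) * x i ≤ (s i : ℤ) * y i) : f x ≤ f y := by
  classical
  -- The coordinates of `x` are replaced by those of `y` one at a time.
  have key : ∀ S : Finset (Fin d), f x ≤ f (S.piecewise y x) := by
    intro S
    induction S using Finset.induction_on with
    | empty => simp
    | insert j S hj ih =>
      refine ih.trans ?_
      rw [piecewise_insert]
      have hz : S.piecewise y x ∈ Fintype.piFinset B := by
        rw [Fintype.mem_piFinset] at *
        intro i
        by_cases hi : i ∈ S
        · simpa [hi] using hy i
        · simpa [hi] using hx i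
      have hzj : S.piecewise y x j = x j := by simp [hj]
      rcases (hxy j).eq_or_lt with heq | hlt
      · have : y j = S.piecewise y x j := by
          rw [hzj]
          exact (mul_left_cancel₀ (Units.ne_zero (s j)) heq).symm
        rw [this, Function.update_eq_self]
      · have := h j _ hz (x j) (Fintype.mem_piFinset.1 hx j) (y j) (Fintype.mem_piFinset.1 hy j) hlt
        rw [← hzj, Function.update_eq_self] at this
        exact this.le
  simpa using key univ

theorem SignMono.lt_of_forall_le {d : ℕ} {B : Fin d → Finset ℤ} {f : (Fin d → ℤ) → ℝ}
    {s : Fin d → ℤˣ} (h : SignMono B f s) {x y : Fin d → ℤ} (hx : x ∈ Fintype.piFinset B)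
    (hy : y ∈ Fintype.piFinset B) (hxy : ∀ i, (s i : ℤ) * x i ≤ (s i : ℤ) * y i) {j : Fin d}
    (hj : (s j : ℤ) * x j < (s j : ℤ) * y j) : f x < f y := by
  have h1 := h j x hx (x j) (Fintype.mem_piFinset.1 hx j) (y j) (Fintype.mem_piFinset.1 hy j) hj
  rw [Function.update_eq_self] at h1
  refine h1.trans_le (h.le_of_forall_le ?_ hy fun i => ?_)
  · rw [Fintype.mem_piFinset] at *
    intro i
    by_cases hi : i = j
    · subst hi; simpa using hy i
    · simpa [hi] using hx i
  · by_cases hi : i = j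
    · subst hi; simp
    · simpa [hi] using hxy i

theorem exists_sign_enumeration (B : Finset ℤ) (s : ℤˣ) :
    ∃ e : ℕ → ℤ, (∀ k < B.card, e k ∈ B) ∧
      StrictMonoOn (fun k => (s : ℤ) * e k) (Set.Iio B.card) := by
  classical
  have hss : ∀ a : ℤ, (s : ℤ) * ((s : ℤ) * a) = a := fun a => by
    rw [← mul_assoc, ← Units.val_mul, Int.units_mul_self, Units.val_one, one_mul]
  have hcard : (B.image fun a => (s : ℤ) * a).card = B.card :=
    card_image_of_injective _ (mul_right_injective₀ (Units.ne_zero s))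
  refine ⟨fun k => if h : k < B.card then
    (s : ℤ) * (B.image fun a => (s : ℤ) * a).orderEmbOfFin hcard ⟨k, h⟩ else 0, ?_, ?_⟩
  · intro k hk
    simp only [hk, dif_pos]
    obtain ⟨a, ha, hak⟩ := mem_image.1
      ((B.image fun a => (s : ℤ) * a).orderEmbOfFin_mem hcard ⟨k, hk⟩)
    rw [← hak, hss]
    exact ha
  · intro k hk l hl hkl
    have hk' : k < B.card := hk
    have hl' : l < B.card := hl
    simp only [hk', hl', dif_pos, hss]
    exact (OrderEmbedding.lt_iff_lt _).2 hkl

/-- Enumerating each side of a monotone subarray in the order given by its sign makes the array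
strictly increasing on `{0, …, s - 1}^d`. The ordered subgrid found there is carried back with the
same signs. -/
theorem mem_lexRamseySet {d N s n : ℕ} {R : Fin d → ℕ} (hN : 0 < N) (hRN : ∀ i, R i ≤ N)
    (hmono : MonoRamsey R fun _ => s) (hlex : MonoLexRamsey d s n) : N ∈ lexRamseySet d n := by
  classical
  refine ⟨hN, fun A f hA hAN => ?_⟩
  obtain ⟨B, hB, ε, hε⟩ := hmono A f (fun i => (hRN i).trans (hAN i).ge)
    (by rw [← grid_eq_coe_piFinset]; exact hA.2)
  have hBs : ∀ i, (B i).card = s := fun i => (mem_subgrids.1 hB i).2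
  choose e heB he using fun i => exists_sign_enumeration (B i) (ε i)
  simp only [hBs] at heB he
  have hmem : ∀ x ∈ {x : Fin d → ℕ | ∀ i, x i < s}, (fun i => e i (x i)) ∈ Fintype.piFinset B :=
    fun x hx => Fintype.mem_piFinset.2 fun i => heB i _ (hx i)
  obtain ⟨C, hC, σ, hσ⟩ := hlex (fun x => f fun i => e i (x i)) (by
    intro x hx y hy hxy
    obtain ⟨hle, j, hj⟩ := Pi.lt_def.1 hxy
    exact hε.lt_of_forall_le (hmem x hx) (hmem y hy)
      (fun i => (he i).monotoneOn (hx i) (hy i) (hle i)) (he j (hx j) (hy j) hj))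
  have hCs : ∀ i, ∀ k ∈ C i, k < s := fun i k hk => mem_range.1 ((mem_subgrids.1 hC i).1 hk)
  have he' : ∀ i, StrictMonoOn (fun k => (ε i : ℤ) * e i k) (C i) := fun i =>
    (he i).mono fun k hk => hCs i k hk
  refine ⟨fun i => (C i).image (e i), fun i t ht => ?_, fun i => ?_, σ, ε, ?_⟩
  · obtain ⟨k, hk, rfl⟩ := mem_image.1 ht
    exact (mem_subgrids.1 hB i).1 (heB i k (hCs i k hk))
  · rw [card_image_of_injOn, (mem_subgrids.1 hC i).2]
    intro k hk l hl hkl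
    exact (he' i).injOn hk hl (congrArg _ hkl)
  · simp only [grid_eq_coe_piFinset, mem_coe]
    exact hσ.image (φ := fun i t => (ε i : ℤ) * t) he'

/-! ### Explicit bounds in dimensions two and three -/

theorem MonoRamsey.mono {d : ℕ} {R R' n : Fin d → ℕ} (h : MonoRamsey R n) (hR : ∀ i, R i ≤ R' i) :
    MonoRamsey R' n := fun A f hA hf => h A f (fun i => (hR i).trans (hA i)) hf

theorem LineRamsey.mono {d : ℕ} {R R' n : Fin d → ℕ} (h : LineRamsey R n) (hR : ∀ i, R i ≤ R' i) :
    LineRamsey R' n := fun A f hA hf => h A f (fun i => (hR i).trans (hA i)) hf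

theorem GridRamsey.mono {κ : Type} {d : ℕ} {w w' n : Fin d → ℕ} (h : GridRamsey κ w n)
    (hw : ∀ i, w i ≤ w' i) : GridRamsey κ w' n := fun A f hA => h A f fun i => (hw i).trans (hA i)

theorem cons_const {d : ℕ} (a : ℕ) :
    (Fin.cons a fun _ : Fin d => a : Fin (d + 1) → ℕ) = fun _ => a :=
  funext <| Fin.cases rfl fun _ => rfl

theorem gridRamsey_one (m : ℕ) :
    GridRamsey ℤˣ (fun _ : Fin 1 => 2 * m) fun _ => m := by
  have := (gridRamsey_zero ℤˣ (fun _ => 2 * m) fun _ => m).cons (W := 2 * m) (k := m) (by simp)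
  rwa [cons_const, cons_const] at this

theorem monoRamsey_one {m : ℕ} (hm : 1 ≤ m) :
    MonoRamsey (fun _ : Fin 1 => m ^ 2) fun _ => m := by
  have := (monoRamsey_zero (fun _ => m ^ 2) fun _ => m).cons
    (gridRamsey_zero ℤˣ (fun _ => m) fun _ => m) (N := m ^ 2) hm (by simp)
  rwa [cons_const, cons_const] at this

theorem sq_le_two_pow (m : ℕ) : m ^ 2 ≤ 2 ^ (2 * m) := by
  rw [mul_comm, pow_mul]
  exact Nat.pow_le_pow_left Nat.lt_two_pow_self.le 2

theorem monoRamsey_two {w W u : ℕ} (hw : 1 ≤ w) (hW : 1 ≤ W) (hWu : W ≤ 2 ^ u) :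
    MonoRamsey (Fin.cons (2 ^ (8 * w ^ 2 + 1 + 2 * u * 4 ^ w)) fun _ : Fin 1 => (2 * w) ^ 2 :
      Fin 2 → ℕ) (Fin.cons W fun _ : Fin 1 => w : Fin 2 → ℕ) := by
  refine MonoRamsey.cons (gridRamsey_one w) (monoRamsey_one (by omega)) hW ?_
  simp only [univ_unique, prod_const, card_singleton, pow_one]
  have h1 : ((2 * w) ^ 2).choose (2 * w) ≤ 2 ^ (8 * w ^ 2) := by
    calc ((2 * w) ^ 2).choose (2 * w) ≤ ((2 * w) ^ 2) ^ (2 * w) := Nat.choose_le_pow _ _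
      _ ≤ (2 ^ (2 * (2 * w))) ^ (2 * w) := Nat.pow_le_pow_left (sq_le_two_pow _) _
      _ = 2 ^ (8 * w ^ 2) := by rw [← pow_mul]; ring_nf
  have h2 : W ^ ((2 * w).choose w * 2) ≤ 2 ^ (2 * u * 4 ^ w) := by
    calc W ^ ((2 * w).choose w * 2) ≤ W ^ (4 ^ w * 2) := by
          refine Nat.pow_le_pow_right hW (Nat.mul_le_mul_right _ ?_)
          exact (Nat.choose_le_two_pow _ _).trans (by rw [pow_mul]; norm_num)
      _ ≤ (2 ^ u) ^ (4 ^ w * 2) := Nat.pow_le_pow_left hWu _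
      _ = 2 ^ (2 * u * 4 ^ w) := by rw [← pow_mul]; ring_nf
  calc _ ≤ 2 ^ (8 * w ^ 2) * 2 * 2 ^ (2 * u * 4 ^ w) := by gcongr
    _ = _ := by rw [← pow_succ, ← pow_add]

theorem lexRamseySet_two {n : ℕ} (hn : 1 ≤ n) :
    2 ^ (396 * n ^ 4 * 2 ^ (4 * n ^ 2)) ∈ lexRamseySet 2 n := by
  set m := 2 * n ^ 2 + 1 with hm
  have hm1 : 1 ≤ m := by omega
  have h := monoRamsey_two hm1 hm1 (u := m) Nat.lt_two_pow_self.le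
  rw [cons_const] at h
  have h4 : 1 ≤ 4 ^ m := Nat.one_le_pow _ _ (by norm_num)
  have hm2 : m ≤ m ^ 2 := Nat.le_self_pow (by norm_num) m
  have hE : 8 * m ^ 2 + 1 + 2 * m * 4 ^ m ≤ 396 * n ^ 4 * 2 ^ (4 * n ^ 2) := by
    have h4m : 4 ^ m = 4 * 2 ^ (4 * n ^ 2) := by
      rw [hm, pow_succ, show 4 * n ^ 2 = 2 * (2 * n ^ 2) by ring, pow_mul 2 2]
      norm_num [mul_comm]
    have hmn : m ^ 2 ≤ 9 * n ^ 4 := by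
      have : m ≤ 3 * n ^ 2 := by nlinarith
      calc m ^ 2 ≤ (3 * n ^ 2) ^ 2 := Nat.pow_le_pow_left this 2
        _ = 9 * n ^ 4 := by ring
    have h5 : m ^ 2 ≤ m ^ 2 * 4 ^ m := Nat.le_mul_of_pos_right _ h4
    have h6 : m * 4 ^ m ≤ m ^ 2 * 4 ^ m := Nat.mul_le_mul_right _ hm2
    calc 8 * m ^ 2 + 1 + 2 * m * 4 ^ m ≤ 11 * m ^ 2 * 4 ^ m := by linarith
      _ ≤ 11 * (9 * n ^ 4) * 4 ^ m := by gcongr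
      _ = _ := by rw [h4m]; ring
  refine mem_lexRamseySet (by positivity) ?_ h (monoLexRamsey_two hn)
  refine Fin.cases ?_ fun _ => ?_
  · simpa using Nat.pow_le_pow_right two_pos hE
  · simp only [Fin.cons_succ]
    refine (sq_le_two_pow _).trans (Nat.pow_le_pow_right two_pos (le_trans ?_ hE))
    nlinarith

theorem monoRamsey_three {m : ℕ} (hm : 1 ≤ m) :
    MonoRamsey (fun _ : Fin 3 => 2 ^ 2 ^ (18 * m ^ 2)) fun _ => m := by
  have hm2 : m ≤ m ^ 2 := Nat.le_self_pow (by norm_num) m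
  have hlt : ∀ k : ℕ, k ≤ 2 ^ k := fun k => Nat.lt_two_pow_self.le
  have hchoose : (2 * m).choose m ≤ 2 ^ (2 * m) := Nat.choose_le_two_pow _ _
  -- Unequal sides `2 ^ (4 * m)` and `2 * m` suffice for two colours; keeping one side linear limits
  -- the cost of the next steps.
  have hgrid := (gridRamsey_one m).cons (W := 2 ^ (4 * m)) (k := m) (by
    simp only [univ_unique, prod_const, card_singleton, pow_one, Fintype.card_units_int]
    calc (2 * m).choose m * 2 * m ≤ 2 ^ (2 * m) * 2 * 2 ^ m := by gcongr; exact hlt m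
      _ = 2 ^ (3 * m + 1) := by ring
      _ ≤ 2 ^ (4 * m) := Nat.pow_le_pow_right two_pos (by omega))
  rw [cons_const] at hgrid
  have htwo := monoRamsey_two (w := 2 * m) (W := 2 ^ (4 * m)) (u := 4 * m) (by omega)
    Nat.one_le_two_pow le_rfl
  set E₂ := 8 * (2 * m) ^ 2 + 1 + 2 * (4 * m) * 4 ^ (2 * m) with hE₂
  have hE₂le : E₂ ≤ 2 ^ (6 + 6 * m) := by
    have h1 := sq_le_two_pow m
    have h2 : (1 : ℕ) ≤ 2 ^ (4 * m) := Nat.one_le_two_pow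
    calc E₂ = 32 * m ^ 2 + 1 + 8 * m * 2 ^ (4 * m) := by
          rw [hE₂, show 4 * m = 2 * (2 * m) by ring, pow_mul 2 2]; ring
      _ ≤ 41 * m ^ 2 * 2 ^ (4 * m) := by
          have h5 : m ^ 2 ≤ m ^ 2 * 2 ^ (4 * m) := Nat.le_mul_of_pos_right _ h2
          have h6 : m * 2 ^ (4 * m) ≤ m ^ 2 * 2 ^ (4 * m) := Nat.mul_le_mul_right _ hm2
          linarith
      _ ≤ 2 ^ 6 * 2 ^ (2 * m) * 2 ^ (4 * m) := by gcongr; norm_num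
      _ = 2 ^ (6 + 6 * m) := by ring
  -- The chain term, of order `2 ^ (4 * m ^ 2)` up to lower-order exponents, dominates; the constant
  -- 18 only leaves room for all `m ≥ 1`.
  have hE : E₂ * 2 ^ (4 * m) + 16 * m ^ 2 + 2 + m * ((2 ^ (4 * m)) ^ m * 2 ^ (2 * m) * 2)
      ≤ 2 ^ (18 * m ^ 2) := by
    have h1 : E₂ * 2 ^ (4 * m) ≤ 2 ^ (16 * m ^ 2) := by
      calc E₂ * 2 ^ (4 * m) ≤ 2 ^ (6 + 6 * m) * 2 ^ (4 * m) := by gcongr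
        _ = 2 ^ (6 + 10 * m) := by ring
        _ ≤ 2 ^ (16 * m ^ 2) := Nat.pow_le_pow_right two_pos (by nlinarith)
    have h2 : 16 * m ^ 2 + 2 ≤ 2 * 2 ^ (16 * m ^ 2) := by
      have := hlt (16 * m ^ 2)
      nlinarith
    have h3 : m * ((2 ^ (4 * m)) ^ m * 2 ^ (2 * m) * 2) ≤ 2 ^ (16 * m ^ 2) := by
      calc m * ((2 ^ (4 * m)) ^ m * 2 ^ (2 * m) * 2)
          ≤ 2 ^ m * ((2 ^ (4 * m)) ^ m * 2 ^ (2 * m) * 2) := by gcongr; exact hlt m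
        _ = 2 ^ (4 * m ^ 2 + 3 * m + 1) := by rw [← pow_mul]; ring
        _ ≤ 2 ^ (16 * m ^ 2) := Nat.pow_le_pow_right two_pos (by nlinarith)
    calc _ ≤ 2 ^ (16 * m ^ 2) + 2 * 2 ^ (16 * m ^ 2) + 2 ^ (16 * m ^ 2) := by omega
      _ = 2 ^ (16 * m ^ 2 + 2) := by ring
      _ ≤ 2 ^ (18 * m ^ 2) := Nat.pow_le_pow_right two_pos (by nlinarith)
  have hthree := MonoRamsey.cons (N := 2 ^ 2 ^ (18 * m ^ 2)) (k := m) hgrid htwo hm (by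
    simp only [Fin.prod_univ_succ, Fin.prod_univ_zero, Fin.cons_zero, Fin.cons_succ, mul_one]
    have h1 : (2 ^ E₂).choose (2 ^ (4 * m)) ≤ 2 ^ (E₂ * 2 ^ (4 * m)) :=
      (Nat.choose_le_pow _ _).trans_eq (by rw [← pow_mul])
    have h2 : ((2 * (2 * m)) ^ 2).choose (2 * m) ≤ 2 ^ (16 * m ^ 2) := by
      calc ((2 * (2 * m)) ^ 2).choose (2 * m) ≤ ((2 * (2 * m)) ^ 2) ^ (2 * m) :=
            Nat.choose_le_pow _ _
        _ ≤ (2 ^ (2 * (2 * (2 * m)))) ^ (2 * m) := Nat.pow_le_pow_left (sq_le_two_pow _) _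
        _ = 2 ^ (16 * m ^ 2) := by rw [← pow_mul]; ring_nf
    have h3 : m ^ ((2 ^ (4 * m)).choose m * (2 * m).choose m * 2) ≤
        2 ^ (m * ((2 ^ (4 * m)) ^ m * 2 ^ (2 * m) * 2)) := by
      calc m ^ ((2 ^ (4 * m)).choose m * (2 * m).choose m * 2)
          ≤ m ^ ((2 ^ (4 * m)) ^ m * 2 ^ (2 * m) * 2) := by
            refine Nat.pow_le_pow_right hm ?_
            gcongr
            exact Nat.choose_le_pow _ _
        _ ≤ (2 ^ m) ^ ((2 ^ (4 * m)) ^ m * 2 ^ (2 * m) * 2) := Nat.pow_le_pow_left (hlt m) _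
        _ = _ := by rw [← pow_mul]
    calc _ ≤ 2 ^ (E₂ * 2 ^ (4 * m)) * 2 ^ (16 * m ^ 2) * 2 ^ 2 *
          2 ^ (m * ((2 ^ (4 * m)) ^ m * 2 ^ (2 * m) * 2)) := by gcongr
      _ = 2 ^ (E₂ * 2 ^ (4 * m) + 16 * m ^ 2 + 2 +
          m * ((2 ^ (4 * m)) ^ m * 2 ^ (2 * m) * 2)) := by simp only [pow_add]
      _ ≤ _ := Nat.pow_le_pow_right two_pos hE)
  rw [cons_const] at hthree
  have hpos : 0 < 2 ^ (4 * m) := by positivity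
  refine hthree.mono (Fin.cases le_rfl (Fin.cases ?_ fun _ => ?_))
  · simp only [Fin.cons_succ, Fin.cons_zero]
    refine Nat.pow_le_pow_right two_pos (le_trans ?_ hE)
    have := Nat.le_mul_of_pos_right E₂ hpos
    omega
  · simp only [Fin.cons_succ]
    refine (sq_le_two_pow _).trans (Nat.pow_le_pow_right two_pos (le_trans ?_ hE))
    omega

theorem pow_mul_descFactorial_le {n : ℕ} (hn : 1 ≤ n) {j : ℕ} (hj : j ≤ n) :
    n ^ j * (2 * n ^ 2).descFactorial j ≤ (2 * (n + 1)) ^ j * (n ^ 2).descFactorial j := by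
  induction j with
  | zero => simp
  | succ j ih =>
    have hjn : j ≤ n ^ 2 := (Nat.le_of_succ_le hj).trans (Nat.le_self_pow (by norm_num) n)
    have hstep : n * (2 * n ^ 2 - j) ≤ 2 * (n + 1) * (n ^ 2 - j) := by
      obtain ⟨c, hc⟩ := Nat.exists_eq_add_of_le hjn
      obtain ⟨b, rfl⟩ := Nat.exists_eq_add_of_lt (Nat.lt_of_succ_le hj)
      rw [show 2 * (j + b + 1) ^ 2 - j = j + 2 * c by omega,
        show (j + b + 1) ^ 2 - j = c by omega]
      nlinarith
    rw [Nat.descFactorial_succ, Nat.descFactorial_succ]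
    calc n ^ (j + 1) * ((2 * n ^ 2 - j) * (2 * n ^ 2).descFactorial j)
        = n * (2 * n ^ 2 - j) * (n ^ j * (2 * n ^ 2).descFactorial j) := by ring
      _ ≤ 2 * (n + 1) * (n ^ 2 - j) * ((2 * (n + 1)) ^ j * (n ^ 2).descFactorial j) :=
          Nat.mul_le_mul hstep (ih (Nat.le_of_succ_le hj))
      _ = _ := by ring

theorem succ_pow_self_le (n : ℕ) : (n + 1) ^ n ≤ 3 * n ^ n := by
  rcases Nat.eq_zero_or_pos n with rfl | hn
  · simp
  have hn' : (0 : ℝ) < n := by exact_mod_cast hn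
  have h : (1 + 1 / (n : ℝ)) ^ n ≤ 3 := by
    calc (1 + 1 / (n : ℝ)) ^ n ≤ (Real.exp (1 / n)) ^ n := by
          gcongr
          linarith [Real.add_one_le_exp (1 / (n : ℝ))]
      _ = Real.exp 1 := by
          rw [← Real.exp_nat_mul]
          congr 1
          field_simp
      _ ≤ 3 := Real.exp_one_lt_three.le
  have : ((n : ℝ) + 1) ^ n ≤ 3 * (n : ℝ) ^ n := by
    calc ((n : ℝ) + 1) ^ n = (1 + 1 / (n : ℝ)) ^ n * (n : ℝ) ^ n := by
          rw [← mul_pow]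
          congr 1
          field_simp
      _ ≤ _ := by gcongr
  exact_mod_cast this

/-- The ratio of the binomials is the product of `(2n² - j) / (n² - j)` over `j < n`. Each factor is
at most `2(1 + 1/n)`, and `(1 + 1/n)^n ≤ 3`. -/
theorem choose_two_mul_sq_le {n : ℕ} (hn : 1 ≤ n) :
    (2 * n ^ 2).choose n ≤ 3 * 2 ^ n * (n ^ 2).choose n := by
  have h := pow_mul_descFactorial_le hn le_rfl
  rw [Nat.descFactorial_eq_factorial_mul_choose, Nat.descFactorial_eq_factorial_mul_choose] at h
  have hpos : 0 < n ^ n * n.factorial := by positivity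
  refine Nat.le_of_mul_le_mul_left ?_ hpos
  calc n ^ n * n.factorial * (2 * n ^ 2).choose n
      ≤ (2 * (n + 1)) ^ n * (n.factorial * (n ^ 2).choose n) := by linarith
    _ = 2 ^ n * (n + 1) ^ n * (n.factorial * (n ^ 2).choose n) := by rw [mul_pow]
    _ ≤ 2 ^ n * (3 * n ^ n) * (n.factorial * (n ^ 2).choose n) := by
        gcongr
        exact succ_pow_self_le n
    _ = _ := by ring

/-- The choice `a = n ^ 2` is large enough for the binomial ratio to be at most `3 * 2 ^ n`, yet
contributes only polynomial factors elsewhere. The factor `2 ^ n` becomes the constant 2 of the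
final exponent because the first stage squares `m`. -/
theorem exists_monoLexRamsey_three {n : ℕ} (hn : 1 ≤ n) :
    ∃ m, n ≤ m ∧ m ≤ 325 * n ^ 7 * 2 ^ n ∧ MonoLexRamsey 3 m n := by
  have hn2 : n ≤ n ^ 2 := Nat.le_self_pow (by norm_num) n
  have h2 : 1 ≤ 2 ^ n := Nat.one_le_two_pow
  have hn3 : 1 ≤ n ^ 3 := Nat.one_le_pow _ _ hn
  have hn7 : 1 ≤ n ^ 7 := Nat.one_le_pow _ _ hn
  refine ⟨_, ?_, ?_, monoLexRamsey_three (a := n ^ 2)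
    (M := 2 * (2 * n ^ 2 * n + 1) * n * (3 * 2 ^ n)) hn hn2 ?_⟩
  · have h3 : 1 ≤ 3 * (2 * (2 * n ^ 2 * n + 1) * (3 * 2 ^ n)) * (2 * (2 * n ^ 2 * n + 1)) :=
      Nat.one_le_iff_ne_zero.2 (by positivity)
    calc n ≤ n * (3 * (2 * (2 * n ^ 2 * n + 1) * (3 * 2 ^ n)) * (2 * (2 * n ^ 2 * n + 1))) :=
          Nat.le_mul_of_pos_right _ h3
      _ ≤ _ := by rw [show ∀ a b c : ℕ, n * (3 * (a * b) * c) = 3 * (a * n * b) * c from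
          fun a b c => by ring]; exact Nat.le_succ _
  · have h3 : 2 * n ^ 2 * n + 1 ≤ 3 * n ^ 3 := by nlinarith
    calc 3 * (2 * (2 * n ^ 2 * n + 1) * n * (3 * 2 ^ n)) * (2 * (2 * n ^ 2 * n + 1)) + 1
        ≤ 3 * (2 * (3 * n ^ 3) * n * (3 * 2 ^ n)) * (2 * (3 * n ^ 3)) + n ^ 7 * 2 ^ n := by
          gcongr
          exact Nat.mul_pos hn7 h2
      _ = _ := by ring
  · calc 2 * (2 * n ^ 2 * n + 1) * (2 * n ^ 2).choose n * n
        ≤ 2 * (2 * n ^ 2 * n + 1) * (3 * 2 ^ n * (n ^ 2).choose n) * n := by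
          gcongr
          exact choose_two_mul_sq_le hn
      _ = _ := by ring

theorem lexRamseySet_three {n : ℕ} (hn : 1 ≤ n) :
    2 ^ 2 ^ (18 * 325 ^ 2 * n ^ 14 * 2 ^ (2 * n)) ∈ lexRamseySet 3 n := by
  obtain ⟨m, hnm, hm, hlex⟩ := exists_monoLexRamsey_three hn
  refine mem_lexRamseySet (by positivity) (fun _ => ?_) (monoRamsey_three (hn.trans hnm)) hlex
  refine Nat.pow_le_pow_right two_pos (Nat.pow_le_pow_right two_pos ?_)
  calc 18 * m ^ 2 ≤ 18 * (325 * n ^ 7 * 2 ^ n) ^ 2 := by gcongr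
    _ = _ := by ring

/-! ### Bounds in all dimensions from three on -/

theorem exists_monoLexRamsey {d : ℕ} (hd : 3 ≤ d) : ∃ C, ∀ n, 1 ≤ n →
    ∃ m, n ≤ m ∧ m ≤ 2 ^ (C * n ^ (d - 2)) ∧ MonoLexRamsey d m n := by
  induction d, hd using Nat.le_induction with
  | base =>
    refine ⟨17, fun n hn => ?_⟩
    obtain ⟨m, hnm, hm, hlex⟩ := exists_monoLexRamsey_three hn
    refine ⟨m, hnm, hm.trans ?_, hlex⟩
    calc 325 * n ^ 7 * 2 ^ n ≤ 2 ^ 9 * (2 ^ n) ^ 7 * 2 ^ n := by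
          gcongr
          · norm_num
          · exact Nat.lt_two_pow_self.le
      _ = 2 ^ (9 + 8 * n) := by ring
      _ ≤ _ := Nat.pow_le_pow_right two_pos (by simp; omega)
  | succ d hd ih =>
    obtain ⟨C, hC⟩ := ih
    refine ⟨2 * (d + 1) * d.factorial * d + 1 + C + C * d, fun n hn => ?_⟩
    obtain ⟨m, hnm, hm, hlex⟩ := hC n hn
    have hm1 : 1 ≤ m := hn.trans hnm
    refine ⟨_, ?_, ?_, hlex.succ (by omega) hn hnm⟩
    · have h3 : 1 ≤ (d + 1) * (m.choose n ^ d * d.factorial) * (d * m) := by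
        have := Nat.choose_pos hnm
        have := d.factorial_pos
        have : 0 < d := by omega
        exact Nat.one_le_iff_ne_zero.2 (by positivity)
      calc n ≤ n * ((d + 1) * (m.choose n ^ d * d.factorial) * (d * m)) :=
            Nat.le_mul_of_pos_right _ h3
        _ = (d + 1) * (m.choose n ^ d * d.factorial * n) * (d * m) := by ring
        _ ≤ _ := Nat.le_succ _
    · obtain ⟨e, he⟩ : ∃ e, d - 2 = e := ⟨_, rfl⟩
      rw [he] at hm
      rw [show d + 1 - 2 = e + 1 by omega]
      set X := n ^ e with hX
      have hX1 : 1 ≤ X := Nat.one_le_pow _ _ hn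
      set c := 2 * (d + 1) * d.factorial * d with hc
      -- Choosing `n` elements multiplies the exponent of `m` by `n`, which is why each new
      -- dimension adds one power of `n`.
      have hpow : m.choose n ^ d ≤ 2 ^ (C * X * n * d) := by
        calc m.choose n ^ d ≤ (((2 ^ (C * X)) ^ n)) ^ d := by
              gcongr
              exact (Nat.choose_le_pow _ _).trans (Nat.pow_le_pow_left hm _)
          _ = _ := by simp only [← pow_mul, mul_assoc]
      have hdm : 1 ≤ (d + 1) * (m.choose n ^ d * d.factorial * n) * (d * m) := by
        have := Nat.choose_pos hnm
        have := d.factorial_pos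
        have : 0 < d := by omega
        exact Nat.one_le_iff_ne_zero.2 (by positivity)
      calc (d + 1) * (m.choose n ^ d * d.factorial * n) * (d * m) + 1
          ≤ 2 * ((d + 1) * (m.choose n ^ d * d.factorial * n) * (d * m)) := by omega
        _ = c * n * m.choose n ^ d * m := by rw [hc]; ring
        _ ≤ 2 ^ c * 2 ^ n * 2 ^ (C * X * n * d) * 2 ^ (C * X) := by
            gcongr <;> exact Nat.lt_two_pow_self.le
        _ = 2 ^ (c + n + C * X * n * d + C * X) := by simp only [pow_add]
        _ ≤ 2 ^ ((c + 1 + C + C * d) * n ^ (e + 1)) := by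
            refine Nat.pow_le_pow_right two_pos ?_
            rw [pow_succ, ← hX]
            have h1 : 1 ≤ X * n := Nat.mul_pos hX1 hn
            have h2 : n ≤ X * n := Nat.le_mul_of_pos_left _ hX1
            have h3 : C * X ≤ C * (X * n) :=
              Nat.mul_le_mul_left _ (Nat.le_mul_of_pos_right _ hn)
            have h4 : c ≤ c * (X * n) := Nat.le_mul_of_pos_right _ h1
            nlinarith

/-- The logarithm of the new side is a sum of one term for choosing a common subgrid and one for the
chain. Both are singly exponential in a power of `w`, so the bound stays doubly exponential in every
dimension. -/
theorem exists_lineRamsey (d : ℕ) : ∃ c, ∀ w, 1 ≤ w →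
    LineRamsey (fun _ : Fin d => 2 ^ 2 ^ (c * w ^ d)) fun _ => w := by
  induction d with
  | zero => exact ⟨0, fun w _ => lineRamsey_zero _ _⟩
  | succ d ih =>
    obtain ⟨c, hc⟩ := ih
    refine ⟨c + d + 3, fun w hw => ?_⟩
    have hlt : ∀ k : ℕ, k ≤ 2 ^ k := fun k => Nat.lt_two_pow_self.le
    have h1 : w ^ d ≤ w ^ (d + 1) := Nat.pow_le_pow_right hw (Nat.le_succ d)
    have h2 : w ≤ w ^ (d + 1) := Nat.le_self_pow (by omega) w
    have h3 : 1 ≤ w ^ (d + 1) := Nat.one_le_pow _ _ hw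
    have hE : 2 ^ (c * w ^ d) * w * d + w * 2 ^ w ^ d ≤ 2 ^ ((c + d + 3) * w ^ (d + 1)) := by
      have ha : 2 ^ (c * w ^ d) * w * d ≤ 2 ^ ((c + d + 2) * w ^ (d + 1)) := by
        calc 2 ^ (c * w ^ d) * w * d ≤ 2 ^ (c * w ^ d) * 2 ^ w * 2 ^ d := by
              gcongr <;> exact hlt _
          _ = 2 ^ (c * w ^ d + w + d) := by simp only [pow_add]
          _ ≤ _ := Nat.pow_le_pow_right two_pos (by nlinarith)
      have hb : w * 2 ^ w ^ d ≤ 2 ^ ((c + d + 2) * w ^ (d + 1)) := by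
        calc w * 2 ^ w ^ d ≤ 2 ^ w * 2 ^ w ^ d := by gcongr; exact hlt _
          _ = 2 ^ (w + w ^ d) := by simp only [pow_add]
          _ ≤ _ := Nat.pow_le_pow_right two_pos (by nlinarith)
      calc _ ≤ 2 * 2 ^ ((c + d + 2) * w ^ (d + 1)) := by omega
        _ = 2 ^ ((c + d + 2) * w ^ (d + 1) + 1) := by rw [pow_succ 2, mul_comm]
        _ ≤ _ := Nat.pow_le_pow_right two_pos (by nlinarith)
    have h := (hc w hw).cons (N := 2 ^ 2 ^ ((c + d + 3) * w ^ (d + 1))) (k := w) hw (by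
      simp only [prod_const, card_univ, Fintype.card_fin]
      calc (2 ^ 2 ^ (c * w ^ d)).choose w ^ d * w ^ 2 ^ w ^ d
          ≤ ((2 ^ 2 ^ (c * w ^ d)) ^ w) ^ d * (2 ^ w) ^ 2 ^ w ^ d := by
            gcongr
            · exact Nat.choose_le_pow _ _
            · exact hlt w
        _ = 2 ^ (2 ^ (c * w ^ d) * w * d + w * 2 ^ w ^ d) := by
            simp only [← pow_mul, ← pow_add, mul_assoc]
        _ ≤ _ := Nat.pow_le_pow_right two_pos hE)
    rw [cons_const] at h
    refine h.mono (Fin.cases le_rfl fun _ => ?_)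
    simp only [Fin.cons_succ]
    exact Nat.pow_le_pow_right two_pos (Nat.pow_le_pow_right two_pos (by nlinarith))

theorem exists_gridRamsey (κ : Type) [Fintype κ] [Nonempty κ] (d : ℕ) : ∃ c, ∀ n, 1 ≤ n →
    GridRamsey κ (fun _ : Fin d => 2 ^ (c * n ^ d)) fun _ => n := by
  induction d with
  | zero => exact ⟨0, fun n _ => gridRamsey_zero κ _ _⟩
  | succ d ih =>
    obtain ⟨c, hc⟩ := ih
    set D := Fintype.card κ
    refine ⟨c + c * d + D + 1, fun n hn => ?_⟩
    have hlt : ∀ k : ℕ, k ≤ 2 ^ k := fun k => Nat.lt_two_pow_self.le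
    have h1 : n ^ d ≤ n ^ (d + 1) := Nat.pow_le_pow_right hn (Nat.le_succ d)
    have h2 : n ≤ n ^ (d + 1) := Nat.le_self_pow (by omega) n
    have h3 : 1 ≤ n ^ (d + 1) := Nat.one_le_pow _ _ hn
    have h := (hc n hn).cons (W := 2 ^ ((c + c * d + D + 1) * n ^ (d + 1))) (k := n) (by
      simp only [prod_const, card_univ, Fintype.card_fin]
      calc (2 ^ (c * n ^ d)).choose n ^ d * D * n
          ≤ ((2 ^ (c * n ^ d)) ^ n) ^ d * 2 ^ D * 2 ^ n := by
            gcongr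
            · exact Nat.choose_le_pow _ _
            · exact hlt D
            · exact hlt n
        _ = 2 ^ (c * d * n ^ (d + 1) + D + n) := by
            rw [← pow_mul, ← pow_mul, ← pow_add, ← pow_add]; ring_nf
        _ ≤ _ := Nat.pow_le_pow_right two_pos (by nlinarith))
    rw [cons_const] at h
    refine h.mono (Fin.cases le_rfl fun _ => ?_)
    simp only [Fin.cons_succ]
    exact Nat.pow_le_pow_right two_pos
      ((Nat.mul_le_mul_left _ h1).trans (Nat.mul_le_mul_right _ (by omega)))

theorem exists_monoRamsey (d : ℕ) : ∃ c, ∀ n, 1 ≤ n →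
    MonoRamsey (fun _ : Fin d => 2 ^ 2 ^ 2 ^ (c * n ^ d)) fun _ => n := by
  obtain ⟨c₁, hc₁⟩ := exists_lineRamsey d
  obtain ⟨c₂, hc₂⟩ := exists_gridRamsey (Fin d → ℤˣ) d
  refine ⟨c₁ + c₂ * d, fun n hn => ?_⟩
  have hn1 : 1 ≤ n ^ d := Nat.one_le_pow _ _ hn
  refine ((hc₁ _ Nat.one_le_two_pow).monoRamsey (hc₂ n hn)).mono fun _ => ?_
  refine Nat.pow_le_pow_right two_pos (Nat.pow_le_pow_right two_pos ?_)
  calc c₁ * (2 ^ (c₂ * n ^ d)) ^ d ≤ 2 ^ c₁ * (2 ^ (c₂ * n ^ d)) ^ d := by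
        gcongr
        exact Nat.lt_two_pow_self.le
    _ = 2 ^ (c₁ + c₂ * n ^ d * d) := by rw [← pow_mul, ← pow_add]
    _ ≤ _ := Nat.pow_le_pow_right two_pos (by nlinarith)

theorem exists_lexRamseySet {d : ℕ} (hd : 3 ≤ d) : ∃ C : ℕ, 0 < C ∧ ∀ n, 1 ≤ n →
    2 ^ 2 ^ 2 ^ 2 ^ (C * n ^ (d - 2)) ∈ lexRamseySet d n := by
  obtain ⟨c, hc⟩ := exists_monoRamsey d
  obtain ⟨C, hC⟩ := exists_monoLexRamsey hd
  refine ⟨c + C * d + 1, by omega, fun n hn => ?_⟩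
  obtain ⟨m, hnm, hm, hlex⟩ := hC n hn
  refine mem_lexRamseySet (by positivity) (fun _ => ?_) (hc m (hn.trans hnm)) hlex
  have hX : 1 ≤ n ^ (d - 2) := Nat.one_le_pow _ _ hn
  refine Nat.pow_le_pow_right two_pos (Nat.pow_le_pow_right two_pos
    (Nat.pow_le_pow_right two_pos ?_))
  calc c * m ^ d ≤ 2 ^ c * (2 ^ (C * n ^ (d - 2))) ^ d := by
        gcongr
        exact Nat.lt_two_pow_self.le
    _ = 2 ^ (c + C * n ^ (d - 2) * d) := by rw [← pow_mul, ← pow_add]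
    _ ≤ _ := Nat.pow_le_pow_right two_pos (by nlinarith)

/-! ### Absorbing polynomial factors into o(1) -/

theorem tendsto_logb_mul_pow_div (c : ℝ) (hc : 0 < c) (k : ℕ) :
    Tendsto (fun n : ℕ => Real.logb 2 (c * (n : ℝ) ^ k) / n) atTop (𝓝 0) := by
  have h1 : Tendsto (fun n : ℕ => Real.log n / (n : ℝ)) atTop (𝓝 0) :=
    (Real.isLittleO_log_id_atTop.tendsto_div_nhds_zero).comp tendsto_natCast_atTop_atTop
  have h2 : Tendsto (fun n : ℕ => Real.log c / (n : ℝ)) atTop (𝓝 0) :=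
    tendsto_const_nhds.div_atTop tendsto_natCast_atTop_atTop
  have h3 : Tendsto (fun n : ℕ => (Real.log c / n + k * (Real.log n / n)) / Real.log 2) atTop
      (𝓝 0) := by
    simpa using (h2.add (h1.const_mul (k : ℝ))).div_const (Real.log 2)
  refine h3.congr' ?_
  filter_upwards [eventually_ge_atTop 1] with n hn
  have hn' : (0 : ℝ) < n := by exact_mod_cast hn
  rw [Real.logb, Real.log_mul hc.ne' (by positivity), Real.log_pow]
  field_simp

/-- Defining the error term as the logarithm of the prefactor divided by `x` turns the explicit
bounds into the required form with equality. -/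
theorem two_rpow_add_logb_div_mul {c x a : ℝ} (hc : 0 < c) (hx : x ≠ 0) :
    (2 : ℝ) ^ ((a + Real.logb 2 c / x) * x) = c * (2 : ℝ) ^ (a * x) := by
  rw [add_mul, div_mul_cancel₀ _ hx, Real.rpow_add two_pos,
    Real.rpow_logb two_pos (by norm_num) hc, mul_comm]

theorem theorem3 :
    -- the minimum defining `L_d(n)` exists
    (∀ d n : ℕ, 2 ≤ d → 1 ≤ n → IsLeast (lexRamseySet d n) (lexRamsey d n)) ∧
    -- d = 2
    (∃ ε : ℕ → ℝ, Tendsto ε atTop (𝓝 0) ∧ ∀ n : ℕ, 1 ≤ n →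
      (lexRamsey 2 n : ℝ) ≤ (2 : ℝ) ^ ((2 : ℝ) ^ ((4 + ε n) * (n : ℝ) ^ 2))) ∧
    -- d = 3
    (∃ ε : ℕ → ℝ, Tendsto ε atTop (𝓝 0) ∧ ∀ n : ℕ, 1 ≤ n →
      (lexRamsey 3 n : ℝ) ≤ (2 : ℝ) ^ ((2 : ℝ) ^ ((2 : ℝ) ^ ((2 + ε n) * (n : ℝ))))) ∧
    -- d ≥ 4
    (∀ d : ℕ, 4 ≤ d → ∃ C : ℝ, 0 < C ∧ ∀ n : ℕ, 1 ≤ n →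
      (lexRamsey d n : ℝ) ≤ tower 5 (C * (n : ℝ) ^ (d - 2))) := by
  refine ⟨fun d n hd hn => ?_, ⟨fun n => Real.logb 2 (396 * (n : ℝ) ^ 4) / (n : ℝ) ^ 2, ?_, ?_⟩,
    ⟨fun n => Real.logb 2 (18 * 325 ^ 2 * (n : ℝ) ^ 14) / n,
      tendsto_logb_mul_pow_div _ (by norm_num) _, ?_⟩, ?_⟩
  · have hne : (lexRamseySet d n).Nonempty := by
      rcases hd.eq_or_lt with rfl | hd
      · exact ⟨_, lexRamseySet_two hn⟩
      · obtain ⟨C, -, hC⟩ := exists_lexRamseySet hd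
        exact ⟨_, hC n hn⟩
    exact ⟨Nat.sInf_mem hne, fun N hN => Nat.sInf_le hN⟩
  · have h := (tendsto_logb_mul_pow_div 396 (by norm_num) 4).mul
      (tendsto_inv_atTop_nhds_zero_nat (𝕜 := ℝ))
    rw [zero_mul] at h
    refine h.congr fun n => ?_
    rw [sq, ← div_div, div_eq_mul_inv _ (n : ℝ), div_eq_mul_inv _ (n : ℝ)]
  · intro n hn
    have hn' : (0 : ℝ) < n := by exact_mod_cast hn
    rw [two_rpow_add_logb_div_mul (by positivity) (by positivity)]
    have h : ((lexRamsey 2 n : ℕ) : ℝ) ≤ ((2 ^ (396 * n ^ 4 * 2 ^ (4 * n ^ 2)) : ℕ) : ℝ) :=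
      Nat.cast_le.2 (Nat.sInf_le (lexRamseySet_two hn))
    refine h.trans_eq ?_
    rw [Nat.cast_pow, ← Real.rpow_natCast]
    push_cast
    rw [← Real.rpow_natCast 2 (4 * n ^ 2)]
    push_cast
    rfl
  · intro n hn
    have hn' : (0 : ℝ) < n := by exact_mod_cast hn
    rw [two_rpow_add_logb_div_mul (by positivity) (by positivity)]
    have h : ((lexRamsey 3 n : ℕ) : ℝ) ≤
        ((2 ^ 2 ^ (18 * 325 ^ 2 * n ^ 14 * 2 ^ (2 * n)) : ℕ) : ℝ) :=
      Nat.cast_le.2 (Nat.sInf_le (lexRamseySet_three hn))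
    refine h.trans_eq ?_
    rw [Nat.cast_pow, ← Real.rpow_natCast, Nat.cast_pow, ← Real.rpow_natCast]
    push_cast
    rw [← Real.rpow_natCast 2 (2 * n)]
    push_cast
    norm_num
  · intro d hd
    obtain ⟨C, hC0, hC⟩ := exists_lexRamseySet (d := d) (by omega)
    refine ⟨C, by exact_mod_cast hC0, fun n hn => ?_⟩
    have h : ((lexRamsey d n : ℕ) : ℝ) ≤ ((2 ^ 2 ^ 2 ^ 2 ^ (C * n ^ (d - 2)) : ℕ) : ℝ) :=
      Nat.cast_le.2 (Nat.sInf_le (hC n hn))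
    refine h.trans_eq ?_
    simp only [tower]
    rw [Nat.cast_pow, ← Real.rpow_natCast, Nat.cast_pow, ← Real.rpow_natCast, Nat.cast_pow,
      ← Real.rpow_natCast, Nat.cast_pow, ← Real.rpow_natCast]
    push_cast
    rfl
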